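/- **Setting and conventions.** Let $(\overline M,\overline g)$ and $(\widetilde M,\widetilde g)$ be connected smooth semi-Riemannian manifolds of dimensions $p$ and $n-p$, $1\le p<n$, let $f$ be a positive smooth function on $\overline M$, and let $M=\overline M\times_f\widetilde M$ be the warped product: the manifold $\overline M\times\widetilde M$ with the metric $g=\pi^*\overline g+(f\circ\pi)\,\sigma^*\widetilde g$, where $\pi,\sigma$ are the projections. For a semi-Riemannian metric $g$ put $R_{hijk}=g_{hl}(\partial_k\Gamma^l_{ij}-\partial_j\Gamma^l_{ik}+\Gamma^m_{ij}\Gamma^l_{mk}-\Gamma^m_{ik}\Gamma^l_{mj})$, $S_{jk}=g^{il}R_{ijkl}$, $S^2_{ij}=g^{kl}S_{ik}S_{jl}$; for symmetric $(0,2)$-tensors $A,E$ let $(A\wedge E)_{ijkl}=A_{il}E_{jk}+A_{jk}E_{il}-A_{ik}E_{jl}-A_{jl}E_{ik}$. Bars and tildes denote the objects of $\overline g$ and $\widetilde g$. On $\overline M$ put $f_a=\partial_a f$ and $$T_{ab}=-\tfrac1{2f}\Big(\overline\nabla_b f_a-\tfrac1{2f}f_af_b\Big),\quad T^2_{ab}=\overline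 g^{cd}T_{ac}T_{bd},\quad (\overline S\cdot T)_{ab}=\overline g^{cd}(\overline S_{ac}T_{bd}+T_{ac}\overline S_{bd}),$$ $$P=\tfrac1{4f^2}\overline g^{ab}f_af_b,\qquad Q=f\big(\operatorname{tr}T-(n-p-1)P\big),\qquad \operatorname{tr}T=\overline g^{ab}T_{ab}.$$ **Theorem 5.1.** Let $L_1,\dots,L_6$ be real functions on $M$, and write $q=n-p$. Then $$R=L_1\,g\wedge g+L_2\,g\wedge S+L_3\,S\wedge S+L_4\,g\wedge S^2+L_5\,S\wedge S^2+L_6\,S^2\wedge S^2$$ holds on $M$ if and only if the following three conditions hold at every point $(x,y)$ of $M$ (with $L_i=L_i(x,y)$, the base tensors and $f,P,Q$ taken at $x$, the fiber tensors at $y$). (i) $\overline R=\sum_{r,s=1}^{6}A_{rs}\,V_r\wedge V_s$, where $(V_1,\dots,V_6)=(\overline g,\overline S,\overline S^2,T,T^2,\overline S\cdot T)$ and $$A=\begin{pmatrix} L_1&\frac{L_2}{2}&\frac{L_4}{2}&\frac{qL_2}{2}&\frac{q^2L_4}{2}&\frac{qL_4}{2}\\ \frac{L_2}{2}&L_3&\frac{L_5}{2}&qL_3&\frac{q^2L_5}{2}&\frac{qL_5}{2}\\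 \frac{L_4}{2}&\frac{L_5}{2}&L_6&\frac{qL_5}{2}&q^2L_6&qL_6\\ \frac{qL_2}{2}&qL_3&\frac{qL_5}{2}&q^2L_3&\frac{q^3L_5}{2}&\frac{q^2L_5}{2}\\ \frac{q^2L_4}{2}&\frac{q^2L_5}{2}&q^2L_6&\frac{q^3L_5}{2}&q^4L_6&q^3L_6\\ \frac{qL_4}{2}&\frac{qL_5}{2}&qL_6&\frac{q^2L_5}{2}&q^3L_6&q^2L_6 \end{pmatrix}.$$ (ii) $\sum_{r=1}^{6}\sum_{s=1}^{3}B_{rs}\,(V_r)_{ab}(W_s)_{\alpha\beta}=0$ for all base indices $a,b$ and fiber indices $\alpha,\beta$, where $(W_1,W_2,W_3)=(\widetilde g,\widetilde S,\widetilde S^2)$ and $$B=\begin{pmatrix} -\frac{L_4Q^2}{f}-L_2Q-2fL_1&-L_2-\frac{2L_4Q}{f}&-\frac{L_4}{f}\\ -\frac{L_5Q^2}{f}-2L_3Q-fL_2&-\frac{2(fL_3+L_5Q)}{f}&-\frac{L_5}{f}\\ -\frac{2L_6Q^2}{f}-L_5Q-fL_4&-L_5-\frac{4L_6Q}{f}&-\frac{2L_6}{f}\\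 f(1-qL_2)-\frac{qL_5Q^2}{f}-2qL_3Q&-\frac{2q(fL_3+L_5Q)}{f}&-\frac{qL_5}{f}\\ -\frac{q^2(L_4f^2+L_5Qf+2L_6Q^2)}{f}&-\frac{q^2(fL_5+4L_6Q)}{f}&-\frac{2q^2L_6}{f}\\ -\frac{q(L_4f^2+L_5Qf+2L_6Q^2)}{f}&-\frac{q(fL_5+4L_6Q)}{f}&-\frac{2qL_6}{f} \end{pmatrix}.$$ (iii) $f\widetilde R=\sum_{r,s=1}^{3}C_{rs}\,W_r\wedge W_s$, where $C$ is the symmetric matrix with $$\begin{aligned} C_{11}&=\tfrac{L_6Q^4}{f^2}+\tfrac{L_5Q^3}{f}+(L_3+L_4)Q^2+fL_2Q+f^2L_1+\tfrac{f^2P}{2},\\ C_{12}&=(L_3+L_4)Q+\tfrac{L_2f^3+3L_5Q^2f+4L_6Q^3}{2f^2},\qquad C_{13}=\tfrac12\Big(L_4+\tfrac{Q(fL_5+2L_6Q)}{f^2}\Big),\\ C_{22}&=L_3+\tfrac{2Q(fL_5+2L_6Q)}{f^2},\qquad C_{23}=\tfrac{fL_5+4L_6Q}{2f^2},\qquad C_{33}=\tfrac{L_6}{f^2}.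 \end{aligned}$$ -/

import Mathlib

open scoped Manifold ContDiff Matrix

noncomputable section

namespace WarpedRoter

/-! ### Tensor calculus in coordinates

Coordinates on an open piece of a finite-dimensional real vector space `E` are taken with respect to
a basis `b` of `E`, and `G z` is the matrix of the components `g_{ij}` of a metric at the point
with coordinates `z`. -/

section Coordinates

variable {ι : Type*} [Fintype ι] [DecidableEq ι]
variable {E : Type*} [NormedAddCommGroup E] [NormedSpace ℝ E]

/-- The partial derivative `∂_i h`. -/
def pd (b : Module.Basis ι ℝ E) (i : ι) (h : E → ℝ) (z : E) : ℝ :=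
  fderiv ℝ h z (b i)

/-- The Christoffel symbols `Γ^k_{ij}` of the Levi-Civita connection. -/
def christoffel (b : Module.Basis ι ℝ E) (G : E → Matrix ι ι ℝ) (k i j : ι) (z : E) : ℝ :=
  (1 / 2) * ∑ l, (G z)⁻¹ k l *
    (pd b i (fun w => G w j l) z + pd b j (fun w => G w i l) z - pd b l (fun w => G w i j) z)

/-- The components `R_{hijk}` of the Riemann-Christoffel curvature tensor,
`R_{hijk} = g_{hl} (∂_k Γ^l_{ij} - ∂_j Γ^l_{ik} + Γ^m_{ij} Γ^l_{mk} - Γ^m_{ik} Γ^l_{mj})`. -/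
def riemann (b : Module.Basis ι ℝ E) (G : E → Matrix ι ι ℝ) (z : E) (h i j k : ι) : ℝ :=
  ∑ l, G z h l *
    (pd b k (christoffel b G l i j) z - pd b j (christoffel b G l i k) z
      + ∑ m, (christoffel b G m i j z * christoffel b G l m k z
          - christoffel b G m i k z * christoffel b G l m j z))

/-- The components of the covariant Hessian, `∇_b h_a = ∂_b ∂_a h - Γ^c_{ab} ∂_c h`. -/
def hessian (b : Module.Basis ι ℝ E) (G : E → Matrix ι ι ℝ) (h : E → ℝ) (z : E) :
    Matrix ι ι ℝ :=
  fun i j => pd b j (pd b i h) z - ∑ c, christoffel b G c i j z * pd b c h z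

/-- The trace `g^{il} R_{ijkl}`, where `A` is the inverse matrix `g^{ij}`. -/
def ricciContraction (A : Matrix ι ι ℝ) (R : ι → ι → ι → ι → ℝ) : Matrix ι ι ℝ :=
  fun j k => ∑ i, ∑ l, A i l * R i j k l

/-- The trace `g^{ab} B_{ab}`, where `A` is the inverse matrix `g^{ij}`. -/
def metricTrace (A B : Matrix ι ι ℝ) : ℝ :=
  ∑ i, ∑ j, A i j * B i j

/-- The contracted product `g^{kl} B_{ik} C_{jl}`, where `A` is the inverse matrix `g^{ij}`. For
symmetric `B` and `C` these are the components of the composition of the endomorphisms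
associated with them. -/
def contract (A B C : Matrix ι ι ℝ) : Matrix ι ι ℝ :=
  fun i j => ∑ k, ∑ l, A k l * B i k * C j l

/-- The Kulkarni-Nomizu product
`(A ∧ B)_{ijkl} = A_{il} B_{jk} + A_{jk} B_{il} - A_{ik} B_{jl} - A_{jl} B_{ik}`. -/
def kulkarniNomizu (A B : Matrix ι ι ℝ) (i j k l : ι) : ℝ :=
  A i l * B j k + A j k * B i l - A i k * B j l - A j l * B i k

end Coordinates

/-! ### Semi-Riemannian manifolds -/

section Manifolds

variable {E : Type*} [NormedAddCommGroup E] [NormedSpace ℝ E]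
  {H : Type*} [TopologicalSpace H] (I : ModelWithCorners ℝ E H)
  (M : Type*) [TopologicalSpace M] [ChartedSpace H M] [IsManifold I ∞ M]

/-- A semi-Riemannian metric on a smooth manifold: a symmetric nondegenerate bilinear form on every
tangent space, depending smoothly on the point. Smoothness says that the components are smooth in
the preferred charts (these cover `M`): `tangentCoordChange I x₀ q q u` is the tangent vector
at `q` with constant coordinates `u` in the chart at `x₀`. (On a connected manifold the
index of such a form is constant.) -/
structure SemiRiemannianMetric where
  val : ∀ x : M, TangentSpace I x →ₗ[ℝ] TangentSpace I x →ₗ[ℝ] ℝ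
  symm : ∀ x u v, val x u v = val x v u
  nondegenerate : ∀ x u, (∀ v, val x u v = 0) → u = 0
  smooth : ∀ (x₀ : M) (u v : E),
    ContDiffOn ℝ ∞
      (fun z : E =>
        val ((extChartAt I x₀).symm z)
          (tangentCoordChange I x₀ ((extChartAt I x₀).symm z) ((extChartAt I x₀).symm z) u)
          (tangentCoordChange I x₀ ((extChartAt I x₀).symm z) ((extChartAt I x₀).symm z) v))
      (extChartAt I x₀).target

namespace SemiRiemannianMetric

variable {I M} {ι : Type*} [Fintype ι] [DecidableEq ι]
  (g : SemiRiemannianMetric I M) (b : Module.Basis ι ℝ E)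

/-- The components `g_{ij}` of the metric in the chart at `x₀`, as functions of the coordinates. -/
def coord (x₀ : M) (z : E) : Matrix ι ι ℝ := fun i j =>
  g.val ((extChartAt I x₀).symm z)
    (tangentCoordChange I x₀ ((extChartAt I x₀).symm z) ((extChartAt I x₀).symm z) (b i))
    (tangentCoordChange I x₀ ((extChartAt I x₀).symm z) ((extChartAt I x₀).symm z) (b j))

/-! All tensors at a point `x` are given by their components with respect to the coordinate
basis of the tangent space at `x` that belongs to the chart at `x` and the basis `b`. -/

/-- The metric `g_{ij}` at `x`. -/
def metric (x : M) : Matrix ι ι ℝ := g.coord b x (extChartAt I x x)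

/-- The inverse metric `g^{ij}` at `x`. -/
def inv (x : M) : Matrix ι ι ℝ := (g.metric b x)⁻¹

/-- The Riemann-Christoffel curvature tensor `R` of type `(0,4)` at `x`. -/
def curvature (x : M) : ι → ι → ι → ι → ℝ := riemann b (g.coord b x) (extChartAt I x x)

/-- The Ricci tensor `S_{jk} = g^{il} R_{ijkl}` at `x`. -/
def ricci (x : M) : Matrix ι ι ℝ := ricciContraction (g.inv b x) (g.curvature b x)

/-- The Ricci tensor of level 2, `S²_{ij} = g^{kl} S_{ik} S_{jl}`, at `x`. -/
def ricciSq (x : M) : Matrix ι ι ℝ := contract (g.inv b x) (g.ricci b x) (g.ricci b x)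

/-- The coordinate expression `z ↦ f (φ⁻¹ z)` of a function in the chart `φ` at `x`. -/
def _root_.WarpedRoter.localRep (I : ModelWithCorners ℝ E H) (f : M → ℝ) (x : M) (z : E) : ℝ :=
  f ((extChartAt I x).symm z)

/-- The components `f_a = ∂_a f` of the differential of `f` at `x`. -/
def diff (f : M → ℝ) (x : M) : ι → ℝ :=
  fun a => pd b a (localRep I f x) (extChartAt I x x)

/-- `T_{ab} = -(1/(2f)) (∇_b f_a - (1/(2f)) f_a f_b)` at `x`. -/
def tensorT (f : M → ℝ) (x : M) : Matrix ι ι ℝ := fun a c =>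
  -(1 / (2 * f x)) * (hessian b (g.coord b x) (localRep I f x) (extChartAt I x x) a c
    - (1 / (2 * f x)) * (diff (I := I) b f x a * diff (I := I) b f x c))

/-- `T²_{ac} = g^{kl} T_{ak} T_{cl}` at `x`. -/
def tensorTSq (f : M → ℝ) (x : M) : Matrix ι ι ℝ :=
  contract (g.inv b x) (g.tensorT b f x) (g.tensorT b f x)

/-- The symmetric product `(S·T)_{ac} = g^{kl} (S_{ak} T_{cl} + T_{ak} S_{cl})` at `x`. -/
def tensorST (f : M → ℝ) (x : M) : Matrix ι ι ℝ :=
  contract (g.inv b x) (g.ricci b x) (g.tensorT b f x)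
    + contract (g.inv b x) (g.tensorT b f x) (g.ricci b x)

/-- `P = (1/(4f²)) g^{ab} f_a f_b` at `x`. -/
def scalarP (f : M → ℝ) (x : M) : ℝ :=
  1 / (4 * f x ^ 2) *
    ∑ a, ∑ c, g.inv b x a c * diff (I := I) b f x a * diff (I := I) b f x c

/-- `Q = f (tr T - (q - 1) P)` at `x`, where `q` is the dimension of the fiber. -/
def scalarQ (q : ℕ) (f : M → ℝ) (x : M) : ℝ :=
  f x * (metricTrace (g.inv b x) (g.tensorT b f x) - ((q : ℝ) - 1) * g.scalarP b f x)

/-- The generalized Roter type condition with the associated scalars `L₁, …, L₆`: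
`R = L₁ g∧g + L₂ g∧S + L₃ S∧S + L₄ g∧S² + L₅ S∧S² + L₆ S²∧S²` at every point. -/
def IsGeneralizedRoterTypeWith (L₁ L₂ L₃ L₄ L₅ L₆ : M → ℝ) : Prop :=
  ∀ (x : M) (i j k l : ι),
    g.curvature b x i j k l
      = L₁ x * kulkarniNomizu (g.metric b x) (g.metric b x) i j k l
        + L₂ x * kulkarniNomizu (g.metric b x) (g.ricci b x) i j k l
        + L₃ x * kulkarniNomizu (g.ricci b x) (g.ricci b x) i j k l
        + L₄ x * kulkarniNomizu (g.metric b x) (g.ricciSq b x) i j k l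
        + L₅ x * kulkarniNomizu (g.ricci b x) (g.ricciSq b x) i j k l
        + L₆ x * kulkarniNomizu (g.ricciSq b x) (g.ricciSq b x) i j k l

end SemiRiemannianMetric

end Manifolds

/-! ### Warped products -/

section Warped

variable {E : Type*} [NormedAddCommGroup E] [NormedSpace ℝ E]
  {H : Type*} [TopologicalSpace H] {I : ModelWithCorners ℝ E H}
  {B : Type*} [TopologicalSpace B] [ChartedSpace H B] [IsManifold I ∞ B]
  {E' : Type*} [NormedAddCommGroup E'] [NormedSpace ℝ E']
  {H' : Type*} [TopologicalSpace H'] {I' : ModelWithCorners ℝ E' H'}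
  {F : Type*} [TopologicalSpace F] [ChartedSpace H' F] [IsManifold I' ∞ F]

theorem tangentCoordChange_prod_apply (x₀ q : B × F)
    (hq : q ∈ (extChartAt (I.prod I') x₀).source) (u : E × E') :
    tangentCoordChange (I.prod I') x₀ q q u
      = (tangentCoordChange I x₀.1 q.1 q.1 u.1, tangentCoordChange I' x₀.2 q.2 q.2 u.2) := by
  have hq' := hq
  rw [extChartAt_prod, PartialEquiv.prod_source] at hq'
  have h1 := hasFDerivWithinAt_tangentCoordChange (I := I) (x := x₀.1) (y := q.1) (z := q.1)
    ⟨hq'.1, mem_extChartAt_source q.1⟩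
  have h2 := hasFDerivWithinAt_tangentCoordChange (I := I') (x := x₀.2) (y := q.2) (z := q.2)
    ⟨hq'.2, mem_extChartAt_source q.2⟩
  have h := hasFDerivWithinAt_tangentCoordChange (I := I.prod I') (x := x₀) (y := q) (z := q)
    ⟨hq, mem_extChartAt_source q⟩
  have hr : Set.range (I.prod I') = Set.range I ×ˢ Set.range I' := by
    rw [modelWithCorners_prod_coe, Set.range_prodMap]
  have h3 : HasFDerivWithinAt (extChartAt (I.prod I') q ∘ (extChartAt (I.prod I') x₀).symm)
      ((tangentCoordChange I x₀.1 q.1 q.1).prodMap (tangentCoordChange I' x₀.2 q.2 q.2))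
      (Set.range (I.prod I')) (extChartAt (I.prod I') x₀ q) := by
    have hc : (extChartAt (I.prod I') q ∘ (extChartAt (I.prod I') x₀).symm : E × E' → E × E')
        = Prod.map (extChartAt I q.1 ∘ (extChartAt I x₀.1).symm)
          (extChartAt I' q.2 ∘ (extChartAt I' x₀.2).symm) := by
      rw [extChartAt_prod, extChartAt_prod]
      rfl
    have hp : extChartAt (I.prod I') x₀ q = (extChartAt I x₀.1 q.1, extChartAt I' x₀.2 q.2) := by
      rw [extChartAt_prod]
      rfl
    rw [hr, hc, hp]
    exact HasFDerivWithinAt.prodMap (p := (extChartAt I x₀.1 q.1, extChartAt I' x₀.2 q.2))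
      (h1.mono (by rintro _ ⟨z, hz, rfl⟩; exact hz.1))
      (h2.mono (by rintro _ ⟨z, hz, rfl⟩; exact hz.2))
  have hu : UniqueDiffWithinAt ℝ (Set.range (I.prod I')) (extChartAt (I.prod I') x₀ q) :=
    (I.prod I').uniqueDiffOn _ (by rw [extChartAt_coe]; exact Set.mem_range_self _)
  have := hu.eq h h3
  rw [this]
  rfl

/-- The bilinear form `β₁(u₁, v₁) + c β₂(u₂, v₂)` on `V × W`. -/
def prodForm {V W : Type*} [AddCommGroup V] [Module ℝ V] [AddCommGroup W] [Module ℝ W]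
    (β₁ : V →ₗ[ℝ] V →ₗ[ℝ] ℝ) (c : ℝ) (β₂ : W →ₗ[ℝ] W →ₗ[ℝ] ℝ) :
    (V × W) →ₗ[ℝ] (V × W) →ₗ[ℝ] ℝ :=
  LinearMap.mk₂ ℝ (fun u v => β₁ u.1 v.1 + c * β₂ u.2 v.2)
    (by intro u u' v
        simp only [Prod.fst_add, Prod.snd_add, map_add, LinearMap.add_apply]; ring)
    (by intro a u v
        simp only [Prod.smul_fst, Prod.smul_snd, map_smul, LinearMap.smul_apply, smul_eq_mul]; ring)
    (by intro u v v'
        simp only [Prod.fst_add, Prod.snd_add, map_add]; ring)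
    (by intro a u v
        simp only [Prod.smul_fst, Prod.smul_snd, map_smul, smul_eq_mul]; ring)

/-- The warped product metric `π^* g₁ + (f ∘ π) σ^* g₂` on `B × F`; the tangent space of
`B × F` at `(x, y)` is the product of the tangent spaces, and the differentials of the two
projections are the projections of this product. -/
def warpedMetric (g₁ : SemiRiemannianMetric I B) (g₂ : SemiRiemannianMetric I' F)
    (f : B → ℝ) (hf : ContMDiff I 𝓘(ℝ, ℝ) ∞ f) (hpos : ∀ x, 0 < f x) :
    SemiRiemannianMetric (I.prod I') (B × F) where
  val q := prodForm (V := TangentSpace I q.1) (W := TangentSpace I' q.2)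
    (g₁.val q.1) (f q.1) (g₂.val q.2)
  symm q u v := by
    change g₁.val q.1 _ _ + f q.1 * g₂.val q.2 _ _ = g₁.val q.1 _ _ + f q.1 * g₂.val q.2 _ _
    rw [g₁.symm, g₂.symm]
  nondegenerate q u h := by
    change ∀ v : TangentSpace I q.1 × TangentSpace I' q.2,
      g₁.val q.1 u.1 v.1 + f q.1 * g₂.val q.2 u.2 v.2 = 0 at h
    refine Prod.ext (g₁.nondegenerate q.1 _ fun v => ?_) (g₂.nondegenerate q.2 _ fun v => ?_)
    · have := h (v, 0)
      rwa [map_zero, mul_zero, add_zero] at this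
    · have := h (0, v)
      rw [map_zero, zero_add] at this
      exact (mul_eq_zero.1 this).resolve_left (hpos _).ne'
  smooth x₀ u v := by
    have hfs : ContDiffOn ℝ ∞ (fun z => f ((extChartAt I x₀.1).symm z))
        (extChartAt I x₀.1).target :=
      contMDiffOn_iff_contDiffOn.1 (hf.comp_contMDiffOn (contMDiffOn_extChartAt_symm x₀.1))
    have ht : (extChartAt (I.prod I') x₀).target
        = (extChartAt I x₀.1).target ×ˢ (extChartAt I' x₀.2).target := by
      rw [extChartAt_prod, PartialEquiv.prod_target]
    have m1 : Set.MapsTo (Prod.fst : E × E' → E) (extChartAt (I.prod I') x₀).target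
        (extChartAt I x₀.1).target := by
      rw [ht]; exact fun z hz => hz.1
    have m2 : Set.MapsTo (Prod.snd : E × E' → E') (extChartAt (I.prod I') x₀).target
        (extChartAt I' x₀.2).target := by
      rw [ht]; exact fun z hz => hz.2
    refine ContDiffOn.congr
      (((g₁.smooth x₀.1 u.1 v.1).comp contDiff_fst.contDiffOn m1).add
        ((hfs.comp contDiff_fst.contDiffOn m1).mul
          ((g₂.smooth x₀.2 u.2 v.2).comp contDiff_snd.contDiffOn m2))) ?_
    intro z hz
    have hs := (extChartAt (I.prod I') x₀).map_target hz
    have e : (extChartAt (I.prod I') x₀).symm z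
        = ((extChartAt I x₀.1).symm z.1, (extChartAt I' x₀.2).symm z.2) := by
      rw [extChartAt_prod]; rfl
    have a := tangentCoordChange_prod_apply (I := I) (I' := I') x₀ _ hs u
    have a' := tangentCoordChange_prod_apply (I := I) (I' := I') x₀ _ hs v
    change g₁.val _ (tangentCoordChange (I.prod I') x₀ _ _ u).1
        (tangentCoordChange (I.prod I') x₀ _ _ v).1
      + f _ * g₂.val _ (tangentCoordChange (I.prod I') x₀ _ _ u).2
        (tangentCoordChange (I.prod I') x₀ _ _ v).2 = _
    rw [a, a', e]
    rfl

end Warped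

/-! ### The tables of coefficients -/

section Tables

variable (q : ℕ) (f P Q L₁ L₂ L₃ L₄ L₅ L₆ : ℝ)

/-- Coefficients with respect to `ḡ, S̄, S̄², T, T², S̄·T` (rows and columns). -/
def baseTable : Matrix (Fin 6) (Fin 6) ℝ :=
  let m : ℝ := q
  !![L₁, L₂ / 2, L₄ / 2, m * L₂ / 2, m ^ 2 * L₄ / 2, m * L₄ / 2;
    L₂ / 2, L₃, L₅ / 2, m * L₃, m ^ 2 * L₅ / 2, m * L₅ / 2;
    L₄ / 2, L₅ / 2, L₆, m * L₅ / 2, m ^ 2 * L₆, m * L₆;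
    m * L₂ / 2, m * L₃, m * L₅ / 2, m ^ 2 * L₃, m ^ 3 * L₅ / 2, m ^ 2 * L₅ / 2;
    m ^ 2 * L₄ / 2, m ^ 2 * L₅ / 2, m ^ 2 * L₆, m ^ 3 * L₅ / 2, m ^ 4 * L₆, m ^ 3 * L₆;
    m * L₄ / 2, m * L₅ / 2, m * L₆, m ^ 2 * L₅ / 2, m ^ 3 * L₆, m ^ 2 * L₆]

/-- Coefficients with respect to `ḡ, S̄, S̄², T, T², S̄·T` (rows) and `g̃, S̃, S̃²` (columns). -/
def mixedTable : Matrix (Fin 6) (Fin 3) ℝ :=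
  let m : ℝ := q
  !![-(L₄ * Q ^ 2 / f) - L₂ * Q - 2 * f * L₁, -L₂ - 2 * L₄ * Q / f, -(L₄ / f);
    -(L₅ * Q ^ 2 / f) - 2 * L₃ * Q - f * L₂, -(2 * (f * L₃ + L₅ * Q) / f), -(L₅ / f);
    -(2 * L₆ * Q ^ 2 / f) - L₅ * Q - f * L₄, -L₅ - 4 * L₆ * Q / f, -(2 * L₆ / f);
    f * (1 - m * L₂) - m * L₅ * Q ^ 2 / f - 2 * m * L₃ * Q,
      -(2 * m * (f * L₃ + L₅ * Q) / f), -(m * L₅ / f);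
    -(m ^ 2 * (L₄ * f ^ 2 + L₅ * Q * f + 2 * L₆ * Q ^ 2) / f),
      -(m ^ 2 * (f * L₅ + 4 * L₆ * Q) / f), -(2 * m ^ 2 * L₆ / f);
    -(m * (L₄ * f ^ 2 + L₅ * Q * f + 2 * L₆ * Q ^ 2) / f),
      -(m * (f * L₅ + 4 * L₆ * Q) / f), -(2 * m * L₆ / f)]

/-- Coefficients with respect to `g̃, S̃, S̃²` (rows and columns). -/
def fiberTable : Matrix (Fin 3) (Fin 3) ℝ :=
  let gg : ℝ := L₆ * Q ^ 4 / f ^ 2 + L₅ * Q ^ 3 / f + (L₃ + L₄) * Q ^ 2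
    + f * L₂ * Q + f ^ 2 * L₁ + f ^ 2 * P / 2
  let gS : ℝ := (L₃ + L₄) * Q
    + (L₂ * f ^ 3 + 3 * L₅ * Q ^ 2 * f + 4 * L₆ * Q ^ 3) / (2 * f ^ 2)
  let gS2 : ℝ := (L₄ + Q * (f * L₅ + 2 * L₆ * Q) / f ^ 2) / 2
  let SS : ℝ := L₃ + 2 * Q * (f * L₅ + 2 * L₆ * Q) / f ^ 2
  let SS2 : ℝ := (f * L₅ + 4 * L₆ * Q) / (2 * f ^ 2)
  !![gg, gS, gS2;
    gS, SS, SS2;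
    gS2, SS2, L₆ / f ^ 2]

end Tables

/-! ### The three conditions

The base `B` and the fiber `F` have dimensions `p` and `q`, and Cartesian coordinates are used. -/

section Conditions

variable {p q : ℕ}
  {B : Type*} [TopologicalSpace B]
  [ChartedSpace (EuclideanSpace ℝ (Fin p)) B] [IsManifold (𝓡 p) ∞ B]
  {F : Type*} [TopologicalSpace F]
  [ChartedSpace (EuclideanSpace ℝ (Fin q)) F] [IsManifold (𝓡 q) ∞ F]

/-- The standard basis of `ℝⁿ`. -/
def stdBasis (n : ℕ) : Module.Basis (Fin n) ℝ (EuclideanSpace ℝ (Fin n)) :=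
  (EuclideanSpace.basisFun (Fin n) ℝ).toBasis

/-- The tensors `ḡ, S̄, S̄², T, T², S̄·T` at a point of the base. -/
def baseTensors (gB : SemiRiemannianMetric (𝓡 p) B) (f : B → ℝ) (x : B) :
    Fin 6 → Matrix (Fin p) (Fin p) ℝ :=
  ![gB.metric (stdBasis p) x, gB.ricci (stdBasis p) x, gB.ricciSq (stdBasis p) x,
    gB.tensorT (stdBasis p) f x, gB.tensorTSq (stdBasis p) f x, gB.tensorST (stdBasis p) f x]

/-- The tensors `g̃, S̃, S̃²` at a point of the fiber. -/
def fiberTensors (gF : SemiRiemannianMetric (𝓡 q) F) (y : F) :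
    Fin 3 → Matrix (Fin q) (Fin q) ℝ :=
  ![gF.metric (stdBasis q) y, gF.ricci (stdBasis q) y, gF.ricciSq (stdBasis q) y]

/-- The curvature tensor of the base is the Kulkarni-Nomizu quadratic form given by
`baseTable`. -/
def BaseCondition (gB : SemiRiemannianMetric (𝓡 p) B) (q : ℕ) (f : B → ℝ) (x : B)
    (L₁ L₂ L₃ L₄ L₅ L₆ : ℝ) : Prop :=
  ∀ a b c d : Fin p, gB.curvature (stdBasis p) x a b c d =
    ∑ r, ∑ s, baseTable q L₁ L₂ L₃ L₄ L₅ L₆ r s *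
      kulkarniNomizu (baseTensors gB f x r) (baseTensors gB f x s) a b c d

/-- The mixed expression given by `mixedTable` vanishes. -/
def MixedCondition (gB : SemiRiemannianMetric (𝓡 p) B) (gF : SemiRiemannianMetric (𝓡 q) F)
    (f : B → ℝ) (x : B) (y : F) (L₁ L₂ L₃ L₄ L₅ L₆ : ℝ) : Prop :=
  ∀ (a b : Fin p) (α β : Fin q),
    ∑ r, ∑ s,
      mixedTable q (f x) (gB.scalarQ (stdBasis p) q f x) L₁ L₂ L₃ L₄ L₅ L₆ r s *
        (baseTensors gB f x r a b * fiberTensors gF y s α β) = 0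

/-- `f` times the curvature tensor of the fiber is the Kulkarni-Nomizu quadratic form given by
`fiberTable`. -/
def FiberCondition (gB : SemiRiemannianMetric (𝓡 p) B) (gF : SemiRiemannianMetric (𝓡 q) F)
    (f : B → ℝ) (x : B) (y : F) (L₁ L₂ L₃ L₄ L₅ L₆ : ℝ) : Prop :=
  ∀ α β γ δ : Fin q, f x * gF.curvature (stdBasis q) y α β γ δ =
    ∑ r, ∑ s,
      fiberTable (f x) (gB.scalarP (stdBasis p) f x) (gB.scalarQ (stdBasis p) q f x)
          L₁ L₂ L₃ L₄ L₅ L₆ r s *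
        kulkarniNomizu (fiberTensors gF y r) (fiberTensors gF y s) α β γ δ

end Conditions

end WarpedRoter

end

set_option linter.unusedSectionVars false

namespace WarpedRoter

open Filter Topology Set

/-! ### Partial derivatives -/

section PartialDerivatives

variable {ι κ : Type*} [Fintype ι] [Fintype κ]
variable {E : Type*} [NormedAddCommGroup E] [NormedSpace ℝ E]
variable {E' : Type*} [NormedAddCommGroup E'] [NormedSpace ℝ E']

/-! In product coordinates the warped metric is block diagonal, and its Christoffel symbols differ
from those of the factors only through `-½ grad f · g̃` and `½ ∂ log f · δ`. Hence the curvature has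
three essential blocks: `R̄` on the base, `T ⊗ f g̃` (up to index symmetries) on mixed indices, and
`f R̃ - (f²P/2) g̃∧g̃` on the fiber (`riemann_eq_blockCurvature`).

Tracing gives `S = (S̄ + qT) ⊕ (S̃ + Q g̃)`: each factor sees the mixed block through a trace over
the other one, and `Q` collects `f tr T` and the trace of the `P`-term. Squaring with the block
inverse metric gives `S² = (S̄² + q S̄·T + q² T²) ⊕ f⁻¹(S̃² + 2Q S̃ + Q² g̃)` (`ricci_warpedMetric`,
`ricciSq_warpedMetric`). The factor `2Q` uses the symmetry of the Ricci tensor, proved in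
coordinates by `ricciContraction_symm`.

The right-hand side of the Roter condition is a quadratic form, under `∧`, in the block-diagonal
tensors `g, S, S²`. Only the pure and the two-plus-two mixed components can be nonzero, so the
condition separates at each point into a base, a mixed and a fiber equation
(`blockCurvature_eq_roterForm_iff`). Inserting the blocks and collecting coefficients produces the
three tables (`sum_baseTable`, `sum_mixedTable`, `sum_fiberTable`). Everything is pointwise in `L₁,
…, L₆`, so these functions need no regularity. -/

theorem pd_congr (b : Module.Basis ι ℝ E) (i : ι) {h k : E → ℝ} {z : E} (e : h =ᶠ[𝓝 z] k) :
    pd b i h z = pd b i k z := by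
  rw [pd, pd, e.fderiv_eq]

theorem pd_congr_of_eqOn (b : Module.Basis ι ℝ E) (i : ι) {h k : E → ℝ} {U : Set E}
    (hU : IsOpen U) {z : E} (hz : z ∈ U) (e : ∀ w ∈ U, h w = k w) :
    pd b i h z = pd b i k z :=
  pd_congr b i (eventually_of_mem (hU.mem_nhds hz) e)

theorem pd_zero (b : Module.Basis ι ℝ E) (i : ι) (z : E) : pd b i (fun _ => (0 : ℝ)) z = 0 := by
  simp [pd]

theorem pd_eq_zero_of_eqOn (b : Module.Basis ι ℝ E) (i : ι) {h : E → ℝ} {U : Set E}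
    (hU : IsOpen U) {z : E} (hz : z ∈ U) (e : ∀ w ∈ U, h w = 0) : pd b i h z = 0 := by
  rw [pd_congr_of_eqOn b i hU hz e, pd_zero]

theorem pd_mul (b : Module.Basis ι ℝ E) (i : ι) {h k : E → ℝ} {z : E}
    (hh : DifferentiableAt ℝ h z) (hk : DifferentiableAt ℝ k z) :
    pd b i (fun w => h w * k w) z = pd b i h z * k z + h z * pd b i k z := by
  have := fderiv_mul hh hk
  simp only [pd]
  change (fderiv ℝ (h * k) z) (b i) = _
  rw [this]
  simp only [add_apply, smul_apply, smul_eq_mul]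
  ring

theorem pd_const_mul (b : Module.Basis ι ℝ E) (i : ι) {h : E → ℝ} {z : E} (c : ℝ)
    (hh : DifferentiableAt ℝ h z) : pd b i (fun w => c * h w) z = c * pd b i h z := by
  simp only [pd, fderiv_const_mul hh c, smul_apply, smul_eq_mul]

theorem pd_sum (b : Module.Basis ι ℝ E) (i : ι) {h : κ → E → ℝ} {z : E}
    (hh : ∀ l, DifferentiableAt ℝ (h l) z) :
    pd b i (fun w => ∑ l, h l w) z = ∑ l, pd b i (h l) z := by
  simp only [pd, fderiv_fun_sum fun l _ => hh l, sum_apply]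

theorem pd_div (b : Module.Basis ι ℝ E) (i : ι) {h k : E → ℝ} {z : E}
    (hh : DifferentiableAt ℝ h z) (hk : DifferentiableAt ℝ k z) (h0 : k z ≠ 0) :
    pd b i (fun w => h w / k w) z = (pd b i h z * k z - h z * pd b i k z) / k z ^ 2 := by
  have hd : DifferentiableAt ℝ (fun w => h w / k w) z := by
    simpa only [div_eq_mul_inv] using hh.fun_mul (hk.fun_inv h0)
  -- The product rule is applied to `(h/k)·k`, which equals `h` near `z` because `k` stays nonzero
  -- there; solving for the derivative of `h/k` gives the quotient rule.
  have hm := pd_mul b i hd hk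
  rw [pd_congr b i (k := h) ((hk.continuousAt.eventually_ne h0).mono fun w hw => by
    field_simp)] at hm
  field_simp
  rw [hm]
  field_simp
  ring

theorem contDiffOn_pd (b : Module.Basis ι ℝ E) (i : ι) {h : E → ℝ} {U : Set E}
    (hU : IsOpen U) (hh : ContDiffOn ℝ ∞ h U) : ContDiffOn ℝ ∞ (pd b i h) U :=
  (hh.fderiv_of_isOpen hU (by simp)).clm_apply contDiffOn_const

theorem differentiableAt_of_contDiffOn {h : E → ℝ} {U : Set E} (hU : IsOpen U)
    (hh : ContDiffOn ℝ ∞ h U) {z : E} (hz : z ∈ U) : DifferentiableAt ℝ h z :=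
  (hh.contDiffAt (hU.mem_nhds hz)).differentiableAt (by simp)

theorem pd_comm (b : Module.Basis ι ℝ E) (i j : ι) {h : E → ℝ} {U : Set E} (hU : IsOpen U)
    (hh : ContDiffOn ℝ ∞ h U) {z : E} (hz : z ∈ U) :
    pd b i (pd b j h) z = pd b j (pd b i h) z := by
  have hd : DifferentiableAt ℝ (fderiv ℝ h) z :=
    ((hh.fderiv_of_isOpen (m := ∞) hU (by simp)).contDiffAt (hU.mem_nhds hz)).differentiableAt
      (by simp)
  have e : ∀ k l, pd b k (pd b l h) z = fderiv ℝ (fderiv ℝ h) z (b k) (b l) := by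
    intro k l
    have := (hd.hasFDerivAt.clm_apply (hasFDerivAt_const (b l) z)).fderiv
    change fderiv ℝ (fun w => fderiv ℝ h w (b l)) z (b k) = _
    rw [this]
    simp
  rw [e, e]
  exact ((hh.contDiffAt (hU.mem_nhds hz)).isSymmSndFDerivAt
    (by
      rw [minSmoothness_of_isRCLikeNormedField]
      exact WithTop.coe_le_coe.2 le_top)).eq _ _

theorem pd_prod_inl_mul (b : Module.Basis ι ℝ E) (b' : Module.Basis κ ℝ E') (i : ι)
    {h : E → ℝ} {k : E' → ℝ} {z : E × E'} (hh : DifferentiableAt ℝ h z.1)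
    (hk : DifferentiableAt ℝ k z.2) :
    pd (b.prod b') (Sum.inl i) (fun w => h w.1 * k w.2) z = pd b i h z.1 * k z.2 := by
  have := ((hh.hasFDerivAt.comp z hasFDerivAt_fst).mul
    (hk.hasFDerivAt.comp z hasFDerivAt_snd)).fderiv
  change fderiv ℝ ((h ∘ Prod.fst) * (k ∘ Prod.snd)) z _ = _
  rw [this]
  simp [pd, mul_comm]

theorem pd_prod_inr_mul (b : Module.Basis ι ℝ E) (b' : Module.Basis κ ℝ E') (i : κ)
    {h : E → ℝ} {k : E' → ℝ} {z : E × E'} (hh : DifferentiableAt ℝ h z.1)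
    (hk : DifferentiableAt ℝ k z.2) :
    pd (b.prod b') (Sum.inr i) (fun w => h w.1 * k w.2) z = h z.1 * pd b' i k z.2 := by
  have := ((hh.hasFDerivAt.comp z hasFDerivAt_fst).mul
    (hk.hasFDerivAt.comp z hasFDerivAt_snd)).fderiv
  change fderiv ℝ ((h ∘ Prod.fst) * (k ∘ Prod.snd)) z _ = _
  rw [this]
  simp [pd]

theorem pd_prod_inl_fst (b : Module.Basis ι ℝ E) (b' : Module.Basis κ ℝ E') (i : ι)
    {h : E → ℝ} {z : E × E'} (hh : DifferentiableAt ℝ h z.1) :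
    pd (b.prod b') (Sum.inl i) (fun w => h w.1) z = pd b i h z.1 := by
  simpa using pd_prod_inl_mul b b' i (z := z) (k := fun _ => 1) hh (differentiableAt_const _)

theorem pd_prod_inr_fst (b : Module.Basis ι ℝ E) (b' : Module.Basis κ ℝ E') (i : κ)
    {h : E → ℝ} {z : E × E'} (hh : DifferentiableAt ℝ h z.1) :
    pd (b.prod b') (Sum.inr i) (fun w => h w.1) z = 0 := by
  simpa [pd] using pd_prod_inr_mul b b' i (z := z) (k := fun _ => 1) hh (differentiableAt_const _)

theorem pd_prod_inl_snd (b : Module.Basis ι ℝ E) (b' : Module.Basis κ ℝ E') (i : ι)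
    {k : E' → ℝ} {z : E × E'} (hk : DifferentiableAt ℝ k z.2) :
    pd (b.prod b') (Sum.inl i) (fun w => k w.2) z = 0 := by
  simpa [pd] using pd_prod_inl_mul b b' i (z := z) (h := fun _ => 1) (differentiableAt_const _) hk

theorem pd_prod_inr_snd (b : Module.Basis ι ℝ E) (b' : Module.Basis κ ℝ E') (i : κ)
    {k : E' → ℝ} {z : E × E'} (hk : DifferentiableAt ℝ k z.2) :
    pd (b.prod b') (Sum.inr i) (fun w => k w.2) z = pd b' i k z.2 := by
  simpa using pd_prod_inr_mul b b' i (z := z) (h := fun _ => 1) (differentiableAt_const _) hk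

end PartialDerivatives

/-! ### Metrics in coordinates -/

section Metrics

variable {ι : Type*} [Fintype ι] [DecidableEq ι]
variable {E : Type*} [NormedAddCommGroup E] [NormedSpace ℝ E]

/-- The components of a smooth semi-Riemannian metric on an open set of coordinates. -/
structure IsMetricOn (G : E → Matrix ι ι ℝ) (U : Set E) : Prop where
  isOpen : IsOpen U
  symm : ∀ z ∈ U, ∀ i j, G z i j = G z j i
  isUnit_det : ∀ z ∈ U, IsUnit (G z).det
  contDiffOn : ∀ i j, ContDiffOn ℝ ∞ (fun z => G z i j) U

theorem contDiffOn_det {A : E → Matrix ι ι ℝ} {U : Set E}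
    (hA : ∀ i j, ContDiffOn ℝ ∞ (fun z => A z i j) U) : ContDiffOn ℝ ∞ (fun z => (A z).det) U := by
  simp only [Matrix.det_apply']
  exact ContDiffOn.sum fun s _ => contDiffOn_const.mul (contDiffOn_prod fun i _ => hA _ _)

/-- The Christoffel symbols of the first kind. -/
noncomputable def christoffelFirst (b : Module.Basis ι ℝ E) (G : E → Matrix ι ι ℝ) (i j l : ι)
    (z : E) : ℝ :=
  (1 / 2) *
    (pd b i (fun w => G w j l) z + pd b j (fun w => G w i l) z - pd b l (fun w => G w i j) z)

theorem christoffel_eq_sum (b : Module.Basis ι ℝ E) (G : E → Matrix ι ι ℝ) (k i j : ι) (z : E) :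
    christoffel b G k i j z = ∑ l, (G z)⁻¹ k l * christoffelFirst b G i j l z := by
  simp only [christoffel, christoffelFirst, Finset.mul_sum]
  exact Finset.sum_congr rfl fun l _ => by ring

/-- Agreement near `z`, not just at `z`, is needed because the curvature differentiates the symbols
once more. -/
theorem christoffel_congr (b : Module.Basis ι ℝ E) {G G' : E → Matrix ι ι ℝ} {z : E}
    (e : G =ᶠ[𝓝 z] G') (k i j : ι) : christoffel b G k i j =ᶠ[𝓝 z] christoffel b G' k i j := by
  filter_upwards [e.eventually_nhds] with w hw
  have h : ∀ i j, (fun v => G v i j) =ᶠ[𝓝 w] fun v => G' v i j := fun i j =>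
    hw.mono fun v hv => congrFun (congrFun hv i) j
  simp only [christoffel, pd_congr b _ (h _ _), hw.self_of_nhds]

theorem riemann_congr (b : Module.Basis ι ℝ E) {G G' : E → Matrix ι ι ℝ} {z : E}
    (e : G =ᶠ[𝓝 z] G') : riemann b G z = riemann b G' z := by
  funext h i j k
  simp only [riemann, pd_congr b _ (christoffel_congr b e _ _ _),
    (christoffel_congr b e _ _ _).self_of_nhds, e.self_of_nhds]

namespace IsMetricOn

variable {G : E → Matrix ι ι ℝ} {U : Set E} (hG : IsMetricOn G U) (b : Module.Basis ι ℝ E)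

include hG

theorem differentiableAt {z : E} (hz : z ∈ U) (i j : ι) :
    DifferentiableAt ℝ (fun w => G w i j) z :=
  differentiableAt_of_contDiffOn hG.isOpen (hG.contDiffOn i j) hz

/-- Cramer's rule: each cofactor is a determinant whose entries are constants or components of `G`.
-/
theorem contDiffOn_inv (i j : ι) : ContDiffOn ℝ ∞ (fun z => (G z)⁻¹ i j) U := by
  have hd := contDiffOn_det hG.contDiffOn
  have ha : ContDiffOn ℝ ∞ (fun z => (G z).adjugate i j) U := by
    simp only [Matrix.adjugate_apply]
    refine contDiffOn_det fun k l => ?_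
    by_cases h : k = j
    · subst h
      simpa using contDiffOn_const
    · simpa [Matrix.updateRow_ne h] using hG.contDiffOn k l
  have := (hd.inv fun z hz => (hG.isUnit_det z hz).ne_zero).mul ha
  simpa [Matrix.inv_def, Ring.inverse_eq_inv'] using this

theorem contDiffOn_christoffel (k i j : ι) : ContDiffOn ℝ ∞ (christoffel b G k i j) U := by
  have hp : ∀ i j l, ContDiffOn ℝ ∞ (pd b i fun w => G w j l) U := fun i j l =>
    contDiffOn_pd b i hG.isOpen (hG.contDiffOn j l)
  exact contDiffOn_const.mul (ContDiffOn.sum fun l _ =>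
    (hG.contDiffOn_inv k l).mul (((hp _ _ _).add (hp _ _ _)).sub (hp _ _ _)))

theorem differentiableAt_christoffel {z : E} (hz : z ∈ U) (k i j : ι) :
    DifferentiableAt ℝ (christoffel b G k i j) z :=
  differentiableAt_of_contDiffOn hG.isOpen (hG.contDiffOn_christoffel b k i j) hz

theorem pd_symm {z : E} (hz : z ∈ U) (l i j : ι) :
    pd b l (fun w => G w i j) z = pd b l (fun w => G w j i) z :=
  pd_congr_of_eqOn b l hG.isOpen hz fun w hw => hG.symm w hw i j

theorem christoffel_symm {z : E} (hz : z ∈ U) (k i j : ι) :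
    christoffel b G k i j z = christoffel b G k j i z := by
  simp only [christoffel, hG.pd_symm b hz _ i j, add_comm]

theorem inv_symm {z : E} (hz : z ∈ U) (i j : ι) : (G z)⁻¹ i j = (G z)⁻¹ j i := by
  have : (G z)ᵀ = G z := Matrix.ext fun i j => hG.symm z hz j i
  have h := congrFun (congrFun (Matrix.transpose_nonsing_inv (G z)) j) i
  rw [this] at h
  exact h

theorem sum_mul_inv_mul {z : E} (hz : z ∈ U) (i : ι) (v : ι → ℝ) :
    ∑ l, G z i l * ∑ m, (G z)⁻¹ l m * v m = v i := by
  have := congrFun (Matrix.mulVec_mulVec v (G z) (G z)⁻¹) i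
  rw [Matrix.mul_nonsing_inv _ (hG.isUnit_det z hz), Matrix.one_mulVec] at this
  exact this

theorem sum_mul_christoffel {z : E} (hz : z ∈ U) (h i j : ι) :
    ∑ l, G z h l * christoffel b G l i j z = christoffelFirst b G i j h z := by
  simp only [christoffel_eq_sum]
  exact hG.sum_mul_inv_mul hz h fun m => christoffelFirst b G i j m z

/-- Metric compatibility, `∇g = 0`, with the index lowered. -/
theorem christoffelFirst_add {z : E} (hz : z ∈ U) (m k h : ι) :
    christoffelFirst b G m k h z + christoffelFirst b G h k m z = pd b k (fun w => G w h m) z := by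
  simp only [christoffelFirst, hG.pd_symm b hz _ k h, hG.pd_symm b hz _ m k, hG.pd_symm b hz _ m h]
  ring

end IsMetricOn

/-- The components of the gradient of `φ`. -/
noncomputable def gradient (b : Module.Basis ι ℝ E) (G : E → Matrix ι ι ℝ) (φ : E → ℝ) (l : ι)
    (z : E) : ℝ :=
  ∑ m, (G z)⁻¹ l m * pd b m φ z

namespace IsMetricOn

variable {G : E → Matrix ι ι ℝ} {U : Set E} (hG : IsMetricOn G U) (b : Module.Basis ι ℝ E)
  {φ : E → ℝ} (hφ : ContDiffOn ℝ ∞ φ U)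

include hG

theorem sum_mul_gradient {z : E} (hz : z ∈ U) (i : ι) :
    ∑ l, G z i l * gradient b G φ l z = pd b i φ z :=
  hG.sum_mul_inv_mul hz i fun m => pd b m φ z

include hφ

theorem differentiableAt_gradient {z : E} (hz : z ∈ U) (l : ι) :
    DifferentiableAt ℝ (gradient b G φ l) z :=
  differentiableAt_of_contDiffOn hG.isOpen (ContDiffOn.sum fun m _ =>
    (hG.contDiffOn_inv l m).mul (contDiffOn_pd b m hG.isOpen hφ)) hz

/-- The covariant derivative of the gradient is the Hessian. -/
theorem sum_mul_nabla_gradient {z : E} (hz : z ∈ U) (h k : ι) :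
    ∑ l, G z h l * (pd b k (gradient b G φ l) z
      + ∑ m, gradient b G φ m z * christoffel b G l m k z) = hessian b G φ z h k := by
  -- Differentiate `g_{hl} grad^l φ = ∂_h φ`. The derivatives of `g_{hl}` that appear are later
  -- turned into symbols by metric compatibility.
  have h1 : pd b k (pd b h φ) z
      = ∑ l, (pd b k (fun w => G w h l) z * gradient b G φ l z
        + G z h l * pd b k (gradient b G φ l) z) := by
    rw [← pd_congr_of_eqOn b k hG.isOpen hz fun w hw => hG.sum_mul_gradient b (φ := φ) hw h,
      pd_sum b k fun l =>
        (hG.differentiableAt hz h l).fun_mul (hG.differentiableAt_gradient b hφ hz l)]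
    exact Finset.sum_congr rfl fun l _ =>
      pd_mul b k (hG.differentiableAt hz h l) (hG.differentiableAt_gradient b hφ hz l)
  have h2 : ∑ l, G z h l * ∑ m, gradient b G φ m z * christoffel b G l m k z
      = ∑ m, christoffelFirst b G m k h z * gradient b G φ m z := by
    simp only [Finset.mul_sum]
    rw [Finset.sum_comm]
    refine Finset.sum_congr rfl fun m _ => ?_
    rw [← hG.sum_mul_christoffel b hz, Finset.sum_mul]
    exact Finset.sum_congr rfl fun l _ => by ring
  have h3 : ∑ c, christoffel b G c h k z * pd b c φ z
      = ∑ m, christoffelFirst b G h k m z * gradient b G φ m z := by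
    simp only [christoffel_eq_sum, gradient, Finset.sum_mul, Finset.mul_sum]
    rw [Finset.sum_comm]
    refine Finset.sum_congr rfl fun m _ => Finset.sum_congr rfl fun c _ => ?_
    rw [hG.inv_symm hz c m]
    ring
  rw [hessian, h1, h3]
  simp only [mul_add, Finset.sum_add_distrib]
  rw [h2, ← sub_eq_zero]
  simp only [← hG.christoffelFirst_add b hz _ k h, add_mul, Finset.sum_add_distrib]
  ring

end IsMetricOn

end Metrics

/-! ### The warped product in coordinates -/

section WarpedCoordinates

variable {ι κ : Type*} [Fintype ι] [DecidableEq ι] [Fintype κ] [DecidableEq κ]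
variable {E : Type*} [NormedAddCommGroup E] [NormedSpace ℝ E]
variable {E' : Type*} [NormedAddCommGroup E'] [NormedSpace ℝ E']

/-- The components of the warped product metric `g₁ + φ g₂`. -/
def warpedMatrix (g₁ : E → Matrix ι ι ℝ) (φ : E → ℝ) (g₂ : E' → Matrix κ κ ℝ) (z : E × E') :
    Matrix (ι ⊕ κ) (ι ⊕ κ) ℝ :=
  Matrix.fromBlocks (g₁ z.1) 0 0 (φ z.1 • g₂ z.2)

theorem inv_fromBlocks_diag_smul {A : Matrix ι ι ℝ} {D : Matrix κ κ ℝ} {c : ℝ}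
    (hA : IsUnit A.det) (hD : IsUnit D.det) (hc : c ≠ 0) :
    (Matrix.fromBlocks A 0 0 (c • D))⁻¹ = Matrix.fromBlocks A⁻¹ 0 0 (c⁻¹ • D⁻¹) := by
  refine Matrix.inv_eq_right_inv ?_
  rw [Matrix.fromBlocks_multiply]
  simp [Matrix.mul_nonsing_inv _ hA, Matrix.mul_nonsing_inv _ hD, hc]

/-- The data of a warped product on the product of the open sets `U` and `V`. -/
structure IsWarpedOn (g₁ : E → Matrix ι ι ℝ) (φ : E → ℝ) (g₂ : E' → Matrix κ κ ℝ) (U : Set E)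
    (V : Set E') : Prop where
  base : IsMetricOn g₁ U
  fiber : IsMetricOn g₂ V
  contDiffOn : ContDiffOn ℝ ∞ φ U
  ne_zero : ∀ x ∈ U, φ x ≠ 0

namespace IsWarpedOn

variable {g₁ : E → Matrix ι ι ℝ} {φ : E → ℝ} {g₂ : E' → Matrix κ κ ℝ} {U : Set E} {V : Set E'}
  (h : IsWarpedOn g₁ φ g₂ U V) (b : Module.Basis ι ℝ E) (b' : Module.Basis κ ℝ E')
  {z : E × E'} (hz : z ∈ U ×ˢ V)

include h

theorem isOpen : IsOpen (U ×ˢ V) := h.base.isOpen.prod h.fiber.isOpen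

include hz

theorem inv_eq : (warpedMatrix g₁ φ g₂ z)⁻¹
    = Matrix.fromBlocks (g₁ z.1)⁻¹ 0 0 ((φ z.1)⁻¹ • (g₂ z.2)⁻¹) :=
  inv_fromBlocks_diag_smul (h.base.isUnit_det _ hz.1) (h.fiber.isUnit_det _ hz.2)
    (h.ne_zero _ hz.1)

theorem differentiableAt_warping : DifferentiableAt ℝ φ z.1 :=
  differentiableAt_of_contDiffOn h.base.isOpen h.contDiffOn hz.1

theorem pd_inl_base (c i j : ι) :
    pd (b.prod b') (.inl c) (fun w => warpedMatrix g₁ φ g₂ w (.inl i) (.inl j)) z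
      = pd b c (fun w => g₁ w i j) z.1 :=
  pd_prod_inl_fst b b' c (h := fun w => g₁ w i j) (h.base.differentiableAt hz.1 i j)

theorem pd_inr_base (c : κ) (i j : ι) :
    pd (b.prod b') (.inr c) (fun w => warpedMatrix g₁ φ g₂ w (.inl i) (.inl j)) z = 0 :=
  pd_prod_inr_fst b b' c (h := fun w => g₁ w i j) (h.base.differentiableAt hz.1 i j)

omit h hz in
theorem pd_mixed (c : ι ⊕ κ) (i : ι) (j : κ) :
    pd (b.prod b') c (fun w => warpedMatrix g₁ φ g₂ w (.inl i) (.inr j)) z = 0 :=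
  pd_zero _ _ _

omit h hz in
theorem pd_mixed' (c : ι ⊕ κ) (i : κ) (j : ι) :
    pd (b.prod b') c (fun w => warpedMatrix g₁ φ g₂ w (.inr i) (.inl j)) z = 0 :=
  pd_zero _ _ _

theorem pd_inl_fiber (c : ι) (i j : κ) :
    pd (b.prod b') (.inl c) (fun w => warpedMatrix g₁ φ g₂ w (.inr i) (.inr j)) z
      = pd b c φ z.1 * g₂ z.2 i j :=
  pd_prod_inl_mul b b' c (k := fun w => g₂ w i j) (h.differentiableAt_warping hz)
    (h.fiber.differentiableAt hz.2 i j)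

theorem pd_inr_fiber (c i j : κ) :
    pd (b.prod b') (.inr c) (fun w => warpedMatrix g₁ φ g₂ w (.inr i) (.inr j)) z
      = φ z.1 * pd b' c (fun w => g₂ w i j) z.2 :=
  pd_prod_inr_mul b b' c (k := fun w => g₂ w i j) (h.differentiableAt_warping hz)
    (h.fiber.differentiableAt hz.2 i j)

/-! #### The Christoffel symbols -/

theorem christoffel_base (k i j : ι) :
    christoffel (b.prod b') (warpedMatrix g₁ φ g₂) (.inl k) (.inl i) (.inl j) z
      = christoffel b g₁ k i j z.1 := by
  simp [christoffel, h.inv_eq hz, Fintype.sum_sum_type, h.pd_inl_base b b' hz]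

/-- This symbol and the next two vanish because the metric has no mixed components and its base
block does not depend on the fiber coordinates. -/
theorem christoffel_fiber_base_base (k : κ) (i j : ι) :
    christoffel (b.prod b') (warpedMatrix g₁ φ g₂) (.inr k) (.inl i) (.inl j) z = 0 := by
  simp [christoffel, h.inv_eq hz, Fintype.sum_sum_type, pd_mixed, h.pd_inr_base b b' hz]

theorem christoffel_base_base_fiber (k i : ι) (j : κ) :
    christoffel (b.prod b') (warpedMatrix g₁ φ g₂) (.inl k) (.inl i) (.inr j) z = 0 := by
  simp [christoffel, h.inv_eq hz, Fintype.sum_sum_type, pd_mixed, pd_mixed',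
    h.pd_inr_base b b' hz]

theorem christoffel_base_fiber_base (k : ι) (i : κ) (j : ι) :
    christoffel (b.prod b') (warpedMatrix g₁ φ g₂) (.inl k) (.inr i) (.inl j) z = 0 := by
  simp [christoffel, h.inv_eq hz, Fintype.sum_sum_type, pd_mixed, pd_mixed',
    h.pd_inr_base b b' hz]

theorem christoffel_base_fiber_fiber (k : ι) (i j : κ) :
    christoffel (b.prod b') (warpedMatrix g₁ φ g₂) (.inl k) (.inr i) (.inr j) z
      = -(1 / 2) * gradient b g₁ φ k z.1 * g₂ z.2 i j := by
  simp only [christoffel, h.inv_eq hz, Fintype.sum_sum_type, pd_mixed', gradient,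
    h.pd_inl_fiber b b' hz, Matrix.fromBlocks_apply₁₁, Matrix.fromBlocks_apply₁₂,
    Matrix.zero_apply, zero_mul, Finset.sum_const_zero, Finset.mul_sum, Finset.sum_mul, add_zero]
  exact Finset.sum_congr rfl fun l _ => by ring

theorem christoffel_fiber_base_fiber (k : κ) (i : ι) (j : κ) :
    christoffel (b.prod b') (warpedMatrix g₁ φ g₂) (.inr k) (.inl i) (.inr j) z
      = pd b i φ z.1 / (2 * φ z.1) * (1 : Matrix κ κ ℝ) k j := by
  -- The Kronecker delta arises from `g̃⁻¹ g̃`; the factor `φ⁻¹` of the inverse metric turns `∂_i φ`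
  -- into a logarithmic derivative.
  have e : (1 : Matrix κ κ ℝ) k j = ∑ l, (g₂ z.2)⁻¹ k l * g₂ z.2 j l := by
    rw [← Matrix.nonsing_inv_mul _ (h.fiber.isUnit_det _ hz.2), Matrix.mul_apply]
    exact Finset.sum_congr rfl fun l _ => by rw [h.fiber.symm _ hz.2]
  have h0 := h.ne_zero _ hz.1
  simp only [christoffel, h.inv_eq hz, Fintype.sum_sum_type, pd_mixed,
    h.pd_inl_fiber b b' hz, Matrix.fromBlocks_apply₂₁, Matrix.fromBlocks_apply₂₂,
    Matrix.zero_apply, zero_mul, Finset.sum_const_zero, Finset.mul_sum, zero_add, e,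
    Matrix.smul_apply, smul_eq_mul]
  refine Finset.sum_congr rfl fun l _ => ?_
  field_simp
  ring

theorem christoffel_fiber_fiber_base (k i : κ) (j : ι) :
    christoffel (b.prod b') (warpedMatrix g₁ φ g₂) (.inr k) (.inr i) (.inl j) z
      = pd b j φ z.1 / (2 * φ z.1) * (1 : Matrix κ κ ℝ) k i := by
  rw [← h.christoffel_fiber_base_fiber b b' hz k j i]
  simp only [christoffel, h.inv_eq hz, Fintype.sum_sum_type, pd_mixed, pd_mixed',
    h.pd_inl_fiber b b' hz, Matrix.fromBlocks_apply₂₁, Matrix.zero_apply, zero_mul, add_zero,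
    zero_add]

theorem christoffel_fiber (k i j : κ) :
    christoffel (b.prod b') (warpedMatrix g₁ φ g₂) (.inr k) (.inr i) (.inr j) z
      = christoffel b' g₂ k i j z.2 := by
  have h0 := h.ne_zero _ hz.1
  simp only [christoffel, h.inv_eq hz, Fintype.sum_sum_type,
    h.pd_inr_fiber b b' hz, Matrix.fromBlocks_apply₂₁, Matrix.fromBlocks_apply₂₂,
    Matrix.zero_apply, zero_mul, Finset.sum_const_zero, Finset.mul_sum, zero_add,
    Matrix.smul_apply, smul_eq_mul]
  refine Finset.sum_congr rfl fun l _ => ?_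
  field_simp

/-! #### Derivatives of the Christoffel symbols -/

/-- The formulas for the symbols hold on the whole open set `U ×ˢ V`, so they may be differentiated;
this is the pattern for all derivatives below. -/
theorem pd_inl_christoffel_base (c k i j : ι) :
    pd (b.prod b') (.inl c)
        (christoffel (b.prod b') (warpedMatrix g₁ φ g₂) (.inl k) (.inl i) (.inl j)) z
      = pd b c (christoffel b g₁ k i j) z.1 := by
  rw [pd_congr_of_eqOn _ _ h.isOpen hz fun w hw => h.christoffel_base b b' hw k i j]
  exact pd_prod_inl_fst b b' c (h.base.differentiableAt_christoffel b hz.1 k i j)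

theorem pd_inr_christoffel_base (c : κ) (k i j : ι) :
    pd (b.prod b') (.inr c)
        (christoffel (b.prod b') (warpedMatrix g₁ φ g₂) (.inl k) (.inl i) (.inl j)) z = 0 := by
  rw [pd_congr_of_eqOn _ _ h.isOpen hz fun w hw => h.christoffel_base b b' hw k i j]
  exact pd_prod_inr_fst b b' c (h.base.differentiableAt_christoffel b hz.1 k i j)

theorem pd_christoffel_fiber_base_base (c : ι ⊕ κ) (k : κ) (i j : ι) :
    pd (b.prod b') c
      (christoffel (b.prod b') (warpedMatrix g₁ φ g₂) (.inr k) (.inl i) (.inl j)) z = 0 :=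
  pd_eq_zero_of_eqOn _ _ h.isOpen hz fun _ hw => h.christoffel_fiber_base_base b b' hw k i j

theorem pd_christoffel_base_base_fiber (c : ι ⊕ κ) (k i : ι) (j : κ) :
    pd (b.prod b') c
      (christoffel (b.prod b') (warpedMatrix g₁ φ g₂) (.inl k) (.inl i) (.inr j)) z = 0 :=
  pd_eq_zero_of_eqOn _ _ h.isOpen hz fun _ hw => h.christoffel_base_base_fiber b b' hw k i j

theorem pd_christoffel_base_fiber_base (c : ι ⊕ κ) (k : ι) (i : κ) (j : ι) :
    pd (b.prod b') c
      (christoffel (b.prod b') (warpedMatrix g₁ φ g₂) (.inl k) (.inr i) (.inl j)) z = 0 :=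
  pd_eq_zero_of_eqOn _ _ h.isOpen hz fun _ hw => h.christoffel_base_fiber_base b b' hw k i j

theorem pd_inl_christoffel_base_fiber_fiber (c k : ι) (i j : κ) :
    pd (b.prod b') (.inl c)
        (christoffel (b.prod b') (warpedMatrix g₁ φ g₂) (.inl k) (.inr i) (.inr j)) z
      = -(1 / 2) * pd b c (gradient b g₁ φ k) z.1 * g₂ z.2 i j := by
  have hd := h.base.differentiableAt_gradient b h.contDiffOn hz.1 k
  rw [pd_congr_of_eqOn _ _ h.isOpen hz fun w hw => h.christoffel_base_fiber_fiber b b' hw k i j,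
    pd_prod_inl_mul b b' c (h := fun w => -(1 / 2) * gradient b g₁ φ k w)
      (k := fun w => g₂ w i j) (hd.const_mul _) (h.fiber.differentiableAt hz.2 i j),
    pd_const_mul b c _ hd]

theorem pd_inr_christoffel_base_fiber_fiber (c : κ) (k : ι) (i j : κ) :
    pd (b.prod b') (.inr c)
        (christoffel (b.prod b') (warpedMatrix g₁ φ g₂) (.inl k) (.inr i) (.inr j)) z
      = -(1 / 2) * gradient b g₁ φ k z.1 * pd b' c (fun w => g₂ w i j) z.2 := by
  have hd := h.base.differentiableAt_gradient b h.contDiffOn hz.1 k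
  rw [pd_congr_of_eqOn _ _ h.isOpen hz fun w hw => h.christoffel_base_fiber_fiber b b' hw k i j,
    pd_prod_inr_mul b b' c (h := fun w => -(1 / 2) * gradient b g₁ φ k w)
      (k := fun w => g₂ w i j) (hd.const_mul _) (h.fiber.differentiableAt hz.2 i j)]

theorem differentiableAt_pd_warping (i : ι) : DifferentiableAt ℝ (pd b i φ) z.1 :=
  differentiableAt_of_contDiffOn h.base.isOpen (contDiffOn_pd b i h.base.isOpen h.contDiffOn) hz.1

theorem pd_log_warping (c i : ι) :
    pd b c (fun w => pd b i φ w / (2 * φ w)) z.1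
      = pd b c (pd b i φ) z.1 / (2 * φ z.1)
        - pd b i φ z.1 * pd b c φ z.1 / (2 * φ z.1 ^ 2) := by
  have h0 := h.ne_zero _ hz.1
  rw [pd_div b c (h.differentiableAt_pd_warping b hz i)
    ((h.differentiableAt_warping hz).const_mul 2) (mul_ne_zero two_ne_zero h0),
    pd_const_mul b c 2 (h.differentiableAt_warping hz)]
  field_simp

theorem differentiableAt_log_warping (i : ι) :
    DifferentiableAt ℝ (fun w => pd b i φ w / (2 * φ w)) z.1 := by
  have h2 := ((h.differentiableAt_warping hz).const_mul (2 : ℝ)).fun_inv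
    (mul_ne_zero two_ne_zero (h.ne_zero _ hz.1))
  simpa only [div_eq_mul_inv] using (h.differentiableAt_pd_warping b hz i).fun_mul h2

theorem pd_inl_christoffel_fiber_base_fiber (c : ι) (k : κ) (i : ι) (j : κ) :
    pd (b.prod b') (.inl c)
        (christoffel (b.prod b') (warpedMatrix g₁ φ g₂) (.inr k) (.inl i) (.inr j)) z
      = (pd b c (pd b i φ) z.1 / (2 * φ z.1)
        - pd b i φ z.1 * pd b c φ z.1 / (2 * φ z.1 ^ 2)) * (1 : Matrix κ κ ℝ) k j := by
  rw [pd_congr_of_eqOn _ _ h.isOpen hz fun w hw => h.christoffel_fiber_base_fiber b b' hw k i j,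
    pd_prod_inl_mul b b' c (k := fun _ => (1 : Matrix κ κ ℝ) k j)
      (h.differentiableAt_log_warping b hz i) (differentiableAt_const _), h.pd_log_warping b hz]

theorem pd_inr_christoffel_fiber_base_fiber (c : κ) (k : κ) (i : ι) (j : κ) :
    pd (b.prod b') (.inr c)
        (christoffel (b.prod b') (warpedMatrix g₁ φ g₂) (.inr k) (.inl i) (.inr j)) z = 0 := by
  rw [pd_congr_of_eqOn _ _ h.isOpen hz fun w hw => h.christoffel_fiber_base_fiber b b' hw k i j,
    pd_prod_inr_mul b b' c (k := fun _ => (1 : Matrix κ κ ℝ) k j)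
      (h.differentiableAt_log_warping b hz i) (differentiableAt_const _)]
  simp [pd]

theorem pd_christoffel_fiber_fiber_base (c : ι ⊕ κ) (k i : κ) (j : ι) :
    pd (b.prod b') c
        (christoffel (b.prod b') (warpedMatrix g₁ φ g₂) (.inr k) (.inr i) (.inl j)) z
      = pd (b.prod b') c
        (christoffel (b.prod b') (warpedMatrix g₁ φ g₂) (.inr k) (.inl j) (.inr i)) z :=
  pd_congr_of_eqOn _ _ h.isOpen hz fun w hw => by
    rw [h.christoffel_fiber_base_fiber b b' hw, h.christoffel_fiber_fiber_base b b' hw]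

theorem pd_inl_christoffel_fiber (c : ι) (k i j : κ) :
    pd (b.prod b') (.inl c)
        (christoffel (b.prod b') (warpedMatrix g₁ φ g₂) (.inr k) (.inr i) (.inr j)) z = 0 := by
  rw [pd_congr_of_eqOn _ _ h.isOpen hz fun w hw => h.christoffel_fiber b b' hw k i j]
  exact pd_prod_inl_snd b b' c (h.fiber.differentiableAt_christoffel b' hz.2 k i j)

theorem pd_inr_christoffel_fiber (c k i j : κ) :
    pd (b.prod b') (.inr c)
        (christoffel (b.prod b') (warpedMatrix g₁ φ g₂) (.inr k) (.inr i) (.inr j)) z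
      = pd b' c (christoffel b' g₂ k i j) z.2 := by
  rw [pd_congr_of_eqOn _ _ h.isOpen hz fun w hw => h.christoffel_fiber b b' hw k i j]
  exact pd_prod_inr_snd b b' c (h.fiber.differentiableAt_christoffel b' hz.2 k i j)

end IsWarpedOn

end WarpedCoordinates

/-! ### The curvature blocks of a warped product -/

section WarpedCurvature

variable {ι κ : Type*} [Fintype ι] [DecidableEq ι] [Fintype κ] [DecidableEq κ]
variable {E : Type*} [NormedAddCommGroup E] [NormedSpace ℝ E]
variable {E' : Type*} [NormedAddCommGroup E'] [NormedSpace ℝ E']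

theorem sum_mul_add_mul (a x y : ι → ℝ) (c d : ℝ) :
    ∑ i, a i * (c * x i + d * y i) = c * ∑ i, a i * x i + d * ∑ i, a i * y i := by
  rw [Finset.mul_sum, Finset.mul_sum, ← Finset.sum_add_distrib]
  exact Finset.sum_congr rfl fun i _ => by ring

/-- The bracket in the definition is visibly alternating in its last two indices. This leaves twelve
of the sixteen index patterns to compute. -/
theorem riemann_swap (b : Module.Basis ι ℝ E) (G : E → Matrix ι ι ℝ) (z : E) (h i j k : ι) :
    riemann b G z h i k j = -riemann b G z h i j k := by
  simp only [riemann, ← Finset.sum_neg_distrib, ← mul_neg]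
  refine Finset.sum_congr rfl fun l _ => ?_
  rw [← sub_eq_zero]
  simp only [Finset.sum_sub_distrib]
  ring

/-- The tensor `T` of the warping function `φ` in coordinates. -/
noncomputable def warpingTensor (b : Module.Basis ι ℝ E) (G : E → Matrix ι ι ℝ) (φ : E → ℝ)
    (z : E) : Matrix ι ι ℝ := fun a c =>
  -(1 / (2 * φ z)) * (hessian b G φ z a c - (1 / (2 * φ z)) * (pd b a φ z * pd b c φ z))

/-- The scalar `P` of the warping function `φ` in coordinates. -/
noncomputable def warpingScalar (b : Module.Basis ι ℝ E) (G : E → Matrix ι ι ℝ) (φ : E → ℝ)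
    (z : E) : ℝ :=
  1 / (4 * φ z ^ 2) * ∑ a, ∑ c, (G z)⁻¹ a c * pd b a φ z * pd b c φ z

/-- The curvature tensor of a warped product: `A` and `D` are the curvature tensors of the two
factors, `T` is a tensor on the base and `k` one on the fiber. -/
def blockCurvature (A : ι → ι → ι → ι → ℝ) (T : Matrix ι ι ℝ) (k : Matrix κ κ ℝ)
    (D : κ → κ → κ → κ → ℝ) : ι ⊕ κ → ι ⊕ κ → ι ⊕ κ → ι ⊕ κ → ℝ
  | .inl i, .inl j, .inl l, .inl m => A i j l m
  | .inl i, .inr j, .inr l, .inl m => T i m * k j l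
  | .inr i, .inl j, .inl l, .inr m => T j l * k i m
  | .inl i, .inr j, .inl l, .inr m => -(T i l * k j m)
  | .inr i, .inl j, .inr l, .inl m => -(T j m * k i l)
  | .inr i, .inr j, .inr l, .inr m => D i j l m
  | _, _, _, _ => 0

namespace IsWarpedOn

variable {g₁ : E → Matrix ι ι ℝ} {φ : E → ℝ} {g₂ : E' → Matrix κ κ ℝ} {U : Set E} {V : Set E'}
  (h : IsWarpedOn g₁ φ g₂ U V) (b : Module.Basis ι ℝ E) (b' : Module.Basis κ ℝ E')
  {z : E × E'} (hz : z ∈ U ×ˢ V)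

include h hz

theorem sum_gradient_mul_pd :
    ∑ m, gradient b g₁ φ m z.1 * pd b m φ z.1
      = 4 * φ z.1 ^ 2 * warpingScalar b g₁ φ z.1 := by
  have h0 := h.ne_zero _ hz.1
  rw [warpingScalar, ← mul_assoc, mul_one_div_cancel (by positivity), one_mul]
  simp only [gradient, Finset.sum_mul]
  exact Finset.sum_congr rfl fun l _ => Finset.sum_congr rfl fun m _ => by ring

theorem riemann_base (i j k l : ι) :
    riemann (b.prod b') (warpedMatrix g₁ φ g₂) z (.inl i) (.inl j) (.inl k) (.inl l)
      = riemann b g₁ z.1 i j k l := by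
  simp [riemann, Fintype.sum_sum_type, warpedMatrix, h.pd_inl_christoffel_base b b' hz,
    h.christoffel_base b b' hz, h.christoffel_fiber_base_base b b' hz]

theorem riemann_fiber_base_base_base (i : κ) (j k l : ι) :
    riemann (b.prod b') (warpedMatrix g₁ φ g₂) z (.inr i) (.inl j) (.inl k) (.inl l) = 0 := by
  simp [riemann, Fintype.sum_sum_type, warpedMatrix, h.pd_christoffel_fiber_base_base b b' hz,
    h.christoffel_base b b' hz, h.christoffel_fiber_base_base b b' hz]

theorem riemann_base_fiber_base_base (i : ι) (j : κ) (k l : ι) :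
    riemann (b.prod b') (warpedMatrix g₁ φ g₂) z (.inl i) (.inr j) (.inl k) (.inl l) = 0 := by
  simp [riemann, Fintype.sum_sum_type, warpedMatrix, h.pd_christoffel_base_fiber_base b b' hz,
    h.christoffel_base_fiber_base b b' hz]

theorem riemann_base_base_base_fiber (i j k : ι) (l : κ) :
    riemann (b.prod b') (warpedMatrix g₁ φ g₂) z (.inl i) (.inl j) (.inl k) (.inr l) = 0 := by
  simp [riemann, Fintype.sum_sum_type, warpedMatrix, h.pd_christoffel_base_base_fiber b b' hz,
    h.pd_inr_christoffel_base b b' hz,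
    h.christoffel_base_fiber_base b b' hz, h.christoffel_base_base_fiber b b' hz,
    h.christoffel_fiber_base_base b b' hz]

/-- The products of symbols are proportional to `g̃_{kl}`, whose symmetry makes the alternation in
`k, l` cancel. -/
theorem riemann_base_base_fiber_fiber (i j : ι) (k l : κ) :
    riemann (b.prod b') (warpedMatrix g₁ φ g₂) z (.inl i) (.inl j) (.inr k) (.inr l) = 0 := by
  simp [riemann, Fintype.sum_sum_type, warpedMatrix, h.pd_christoffel_base_base_fiber b b' hz,
    h.christoffel_base_fiber_fiber b b' hz, h.christoffel_base_base_fiber b b' hz,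
    h.christoffel_fiber_base_fiber b b' hz, Matrix.one_apply, h.fiber.symm _ hz.2 k l]

/-- The symbols involved are `½ ∂ log φ` times `δ`: their products commute, and the derivatives
cancel since second derivatives of `φ` are symmetric. -/
theorem riemann_fiber_fiber_base_base (i j : κ) (k l : ι) :
    riemann (b.prod b') (warpedMatrix g₁ φ g₂) z (.inr i) (.inr j) (.inl k) (.inl l) = 0 := by
  simp only [riemann, Fintype.sum_sum_type, h.pd_christoffel_fiber_fiber_base b b' hz,
    h.pd_inl_christoffel_fiber_base_fiber b b' hz, h.christoffel_base_fiber_base b b' hz,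
    h.christoffel_fiber_fiber_base b b' hz, pd_comm b l k h.base.isOpen h.contDiffOn hz.1]
  simp only [warpedMatrix, Matrix.fromBlocks_apply₂₁, Matrix.zero_apply, zero_mul, sub_zero,
    Finset.sum_const_zero, zero_add]
  refine Finset.sum_eq_zero fun m _ => ?_
  simp [Matrix.one_apply]
  ring_nf
  simp

/-- Differentiating `-½ grad φ · g̃` covariantly and lowering the index gives `-½ Hess φ · g̃`. The
products with `½ ∂ log φ · δ` add `∂φ ∂φ/(4φ) · g̃`, and the sum is `φ T · g̃`. -/
theorem riemann_base_fiber_fiber_base (i : ι) (j k : κ) (l : ι) :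
    riemann (b.prod b') (warpedMatrix g₁ φ g₂) z (.inl i) (.inr j) (.inr k) (.inl l)
      = warpingTensor b g₁ φ z.1 i l * (φ z.1 * g₂ z.2 j k) := by
  have h0 := h.ne_zero _ hz.1
  have e1 := h.base.sum_mul_nabla_gradient b h.contDiffOn hz.1 i l
  have e2 := h.base.sum_mul_gradient b (φ := φ) hz.1 i
  -- The bracket before its index is lowered, arranged so that `e1` and `e2` apply to its two parts.
  have e : ∀ m, pd (b.prod b') (.inl l)
        (christoffel (b.prod b') (warpedMatrix g₁ φ g₂) (.inl m) (.inr j) (.inr k)) z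
      - pd (b.prod b') (.inr k)
        (christoffel (b.prod b') (warpedMatrix g₁ φ g₂) (.inl m) (.inr j) (.inl l)) z
      + ∑ n, (christoffel (b.prod b') (warpedMatrix g₁ φ g₂) n (.inr j) (.inr k) z
          * christoffel (b.prod b') (warpedMatrix g₁ φ g₂) (.inl m) n (.inl l) z
        - christoffel (b.prod b') (warpedMatrix g₁ φ g₂) n (.inr j) (.inl l) z
          * christoffel (b.prod b') (warpedMatrix g₁ φ g₂) (.inl m) n (.inr k) z)
      = -(1 / 2) * g₂ z.2 j k * (pd b l (gradient b g₁ φ m) z.1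
          + ∑ n, gradient b g₁ φ n z.1 * christoffel b g₁ m n l z.1)
        + pd b l φ z.1 / (4 * φ z.1) * g₂ z.2 j k * gradient b g₁ φ m z.1 := by
    intro m
    simp only [Fintype.sum_sum_type, h.pd_inl_christoffel_base_fiber_fiber b b' hz,
      h.pd_christoffel_base_fiber_base b b' hz, h.christoffel_base_fiber_fiber b b' hz,
      h.christoffel_base b b' hz, h.christoffel_base_fiber_base b b' hz,
      h.christoffel_fiber_fiber_base b b' hz, Matrix.one_apply]
    simp only [mul_add, Finset.mul_sum]
    simp
    field_simp
    simp only [Finset.mul_sum]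
    ring_nf
    congr 1
    rw [← Finset.sum_mul]
    ring
  simp only [riemann, Fintype.sum_sum_type (α₁ := ι) (α₂ := κ)] at e ⊢
  simp only [e]
  simp only [warpedMatrix, Matrix.fromBlocks_apply₁₁, Matrix.fromBlocks_apply₁₂, Matrix.zero_apply,
    zero_mul, Finset.sum_const_zero, add_zero]
  rw [warpingTensor, ← e1, ← e2, sum_mul_add_mul]
  field_simp
  ring

/-- Here the Hessian comes directly from the derivative of `½ ∂ log φ`. Computing this block
separately makes the pair symmetry of the curvature tensor unnecessary. -/
theorem riemann_fiber_base_base_fiber (i : κ) (j k : ι) (l : κ) :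
    riemann (b.prod b') (warpedMatrix g₁ φ g₂) z (.inr i) (.inl j) (.inl k) (.inr l)
      = warpingTensor b g₁ φ z.1 j k * (φ z.1 * g₂ z.2 i l) := by
  have h0 := h.ne_zero _ hz.1
  simp only [riemann, Fintype.sum_sum_type, h.pd_inl_christoffel_fiber_base_fiber b b' hz,
    h.pd_christoffel_fiber_base_base b b' hz, h.christoffel_base_base_fiber b b' hz,
    h.christoffel_fiber_fiber_base b b' hz, h.christoffel_fiber_base_fiber b b' hz,
    h.christoffel_fiber_base_base b b' hz, h.christoffel_base b b' hz]
  simp [warpedMatrix, Matrix.one_apply, warpingTensor, hessian]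
  rw [Finset.sum_eq_single l (fun m _ hm => by simp [hm]) (by simp)]
  simp only [if_true, mul_div_assoc', ← Finset.sum_div]
  field_simp
  ring

theorem riemann_fiber_fiber_fiber_base (i j k : κ) (l : ι) :
    riemann (b.prod b') (warpedMatrix g₁ φ g₂) z (.inr i) (.inr j) (.inr k) (.inl l) = 0 := by
  simp only [riemann, Fintype.sum_sum_type, h.pd_inl_christoffel_fiber b b' hz,
    h.pd_christoffel_fiber_fiber_base b b' hz, h.pd_inr_christoffel_fiber_base_fiber b b' hz,
    h.christoffel_base_fiber_base b b' hz,
    h.christoffel_fiber_fiber_base b b' hz, h.christoffel_fiber b b' hz,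
    h.christoffel_fiber_base_base b b' hz]
  simp [warpedMatrix, Matrix.one_apply, mul_comm]

theorem riemann_fiber_base_fiber_fiber (i : κ) (j : ι) (k l : κ) :
    riemann (b.prod b') (warpedMatrix g₁ φ g₂) z (.inr i) (.inl j) (.inr k) (.inr l) = 0 := by
  simp only [riemann, Fintype.sum_sum_type,
    h.pd_inr_christoffel_fiber_base_fiber b b' hz,
    h.christoffel_base_base_fiber b b' hz,
    h.christoffel_fiber_base_fiber b b' hz, h.christoffel_fiber b b' hz]
  simp [warpedMatrix, Matrix.one_apply, h.fiber.christoffel_symm b' hz.2 _ l k]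

/-- Up to the factor `-½ grad φ` this is the alternation of `∇̃g̃ = 0`: the terms `∂_l g̃_{jk} - ∂_k
g̃_{jl}` cancel against the symbols of the first kind. -/
theorem riemann_base_fiber_fiber_fiber (i : ι) (j k l : κ) :
    riemann (b.prod b') (warpedMatrix g₁ φ g₂) z (.inl i) (.inr j) (.inr k) (.inr l) = 0 := by
  have e : ∀ j k l, ∑ m, g₂ z.2 m l * christoffel b' g₂ m j k z.2
      = christoffelFirst b' g₂ j k l z.2 := by
    intro j k l
    rw [← h.fiber.sum_mul_christoffel b' hz.2]
    exact Finset.sum_congr rfl fun m _ => by rw [h.fiber.symm _ hz.2]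
  simp only [riemann, Fintype.sum_sum_type,
    h.pd_inr_christoffel_base_fiber_fiber b b' hz,
    h.christoffel_base_base_fiber b b' hz,
    h.christoffel_base_fiber_fiber b b' hz, h.christoffel_fiber b b' hz]
  simp only [warpedMatrix, Matrix.fromBlocks_apply₁₁, Matrix.fromBlocks_apply₁₂, Matrix.zero_apply,
    zero_mul, mul_zero, sub_zero, Finset.sum_const_zero, zero_add, add_zero]
  refine Finset.sum_eq_zero fun m _ => ?_
  have e' : ∑ n, (christoffel b' g₂ n j k z.2 * (-(1 / 2) * gradient b g₁ φ m z.1 * g₂ z.2 n l)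
      - christoffel b' g₂ n j l z.2 * (-(1 / 2) * gradient b g₁ φ m z.1 * g₂ z.2 n k))
      = -(1 / 2) * gradient b g₁ φ m z.1
        * (christoffelFirst b' g₂ j k l z.2 - christoffelFirst b' g₂ j l k z.2) := by
    rw [← e, ← e, ← Finset.sum_sub_distrib, Finset.mul_sum]
    exact Finset.sum_congr rfl fun _ _ => by ring
  rw [e']
  simp only [christoffelFirst, h.fiber.pd_symm b' hz.2 _ l k]
  ring

/-- A Gauss equation: the correction comes from products of symbols whose summed index lies in the
base, which contribute `|dφ|²/(4φ) = φP`. The `½` appears because `g̃∧g̃` counts each product twice.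
-/
theorem riemann_fiber (i j k l : κ) :
    riemann (b.prod b') (warpedMatrix g₁ φ g₂) z (.inr i) (.inr j) (.inr k) (.inr l)
      = φ z.1 * riemann b' g₂ z.2 i j k l - φ z.1 ^ 2 / 2 * warpingScalar b g₁ φ z.1
        * kulkarniNomizu (g₂ z.2) (g₂ z.2) i j k l := by
  have h0 := h.ne_zero _ hz.1
  have e := h.sum_gradient_mul_pd b hz
  simp only [riemann, Fintype.sum_sum_type,
    h.pd_inr_christoffel_fiber b b' hz,
    h.christoffel_fiber_base_fiber b b' hz,
    h.christoffel_base_fiber_fiber b b' hz, h.christoffel_fiber b b' hz]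
  -- The base part of the sum over the intermediate index, i.e. the second fundamental form term.
  have e' : ∀ m, ∑ n, (-(1 / 2) * gradient b g₁ φ n z.1 * g₂ z.2 j k
        * (pd b n φ z.1 / (2 * φ z.1) * (1 : Matrix κ κ ℝ) m l)
      - -(1 / 2) * gradient b g₁ φ n z.1 * g₂ z.2 j l
        * (pd b n φ z.1 / (2 * φ z.1) * (1 : Matrix κ κ ℝ) m k))
      = -(φ z.1 * warpingScalar b g₁ φ z.1)
        * (g₂ z.2 j k * (1 : Matrix κ κ ℝ) m l - g₂ z.2 j l * (1 : Matrix κ κ ℝ) m k) := by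
    intro m
    have : φ z.1 * warpingScalar b g₁ φ z.1
        = (∑ n, gradient b g₁ φ n z.1 * pd b n φ z.1) / (4 * φ z.1) := by
      rw [e]; field_simp
    rw [this, Finset.sum_div, ← Finset.sum_neg_distrib, Finset.sum_mul]
    exact Finset.sum_congr rfl fun _ _ => by field_simp; ring
  have e1 : ∑ m, g₂ z.2 i m
        * (g₂ z.2 j k * (1 : Matrix κ κ ℝ) m l - g₂ z.2 j l * (1 : Matrix κ κ ℝ) m k)
      = g₂ z.2 i l * g₂ z.2 j k - g₂ z.2 i k * g₂ z.2 j l := by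
    simp [Matrix.one_apply, mul_sub]
  simp only [e', warpedMatrix, Matrix.fromBlocks_apply₂₁, Matrix.fromBlocks_apply₂₂,
    Matrix.zero_apply, zero_mul, Finset.sum_const_zero, zero_add, Matrix.smul_apply, smul_eq_mul]
  have e2 := sum_mul_add_mul (g₂ z.2 i)
    (fun m => pd b' l (christoffel b' g₂ m j k) z.2 - pd b' k (christoffel b' g₂ m j l) z.2
      + ∑ n, (christoffel b' g₂ n j k z.2 * christoffel b' g₂ m n l z.2
        - christoffel b' g₂ n j l z.2 * christoffel b' g₂ m n k z.2))
    (fun m => g₂ z.2 j k * (1 : Matrix κ κ ℝ) m l - g₂ z.2 j l * (1 : Matrix κ κ ℝ) m k)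
    (φ z.1) (-(φ z.1 ^ 2 * warpingScalar b g₁ φ z.1))
  rw [e1] at e2
  rw [kulkarniNomizu]
  refine Eq.trans (Finset.sum_congr rfl fun m _ => ?_) (e2.trans ?_)
  · ring
  · ring

theorem riemann_eq_blockCurvature :
    riemann (b.prod b') (warpedMatrix g₁ φ g₂) z
      = blockCurvature (riemann b g₁ z.1) (warpingTensor b g₁ φ z.1) (φ z.1 • g₂ z.2)
        (fun i j k l => φ z.1 * riemann b' g₂ z.2 i j k l
          - φ z.1 ^ 2 / 2 * warpingScalar b g₁ φ z.1
            * kulkarniNomizu (g₂ z.2) (g₂ z.2) i j k l) := by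
  funext i j k l
  rcases i with i | i <;> rcases j with j | j <;> rcases k with k | k <;> rcases l with l | l
  · exact h.riemann_base b b' hz i j k l
  · exact h.riemann_base_base_base_fiber b b' hz i j k l
  · rw [riemann_swap, h.riemann_base_base_base_fiber b b' hz i j l k, neg_zero]
    rfl
  · exact h.riemann_base_base_fiber_fiber b b' hz i j k l
  · exact h.riemann_base_fiber_base_base b b' hz i j k l
  · rw [riemann_swap, h.riemann_base_fiber_fiber_base b b' hz]
    rfl
  · exact h.riemann_base_fiber_fiber_base b b' hz i j k l
  · exact h.riemann_base_fiber_fiber_fiber b b' hz i j k l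
  · exact h.riemann_fiber_base_base_base b b' hz i j k l
  · exact h.riemann_fiber_base_base_fiber b b' hz i j k l
  · rw [riemann_swap, h.riemann_fiber_base_base_fiber b b' hz]
    rfl
  · exact h.riemann_fiber_base_fiber_fiber b b' hz i j k l
  · exact h.riemann_fiber_fiber_base_base b b' hz i j k l
  · rw [riemann_swap, h.riemann_fiber_fiber_fiber_base b b' hz i j l k, neg_zero]
    rfl
  · exact h.riemann_fiber_fiber_fiber_base b b' hz i j k l
  · exact h.riemann_fiber b b' hz i j k l

end IsWarpedOn

end WarpedCurvature

/-! ### Algebra of block-diagonal tensors and the coefficient tables -/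

section BlockAlgebra

variable {ι κ : Type*} [Fintype ι] [DecidableEq ι] [Fintype κ] [DecidableEq κ]

/-- The factors are coupled only by the `T ⊗ k` components, each traced over the opposite factor. -/
theorem ricciContraction_blockCurvature (A : Matrix ι ι ℝ) (D : Matrix κ κ ℝ)
    (Rb : ι → ι → ι → ι → ℝ) (T : Matrix ι ι ℝ) (k : Matrix κ κ ℝ) (Rf : κ → κ → κ → κ → ℝ) :
    ricciContraction (Matrix.fromBlocks A 0 0 D) (blockCurvature Rb T k Rf)
      = Matrix.fromBlocks (ricciContraction A Rb + metricTrace D k • T) 0 0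
        (metricTrace A T • k + ricciContraction D Rf) := by
  ext i j
  rcases i with i | i <;> rcases j with j | j <;>
    simp [ricciContraction, Fintype.sum_sum_type, blockCurvature, metricTrace, Finset.sum_mul]
  · exact Finset.sum_congr rfl fun l _ => Finset.sum_congr rfl fun m _ => by ring
  · exact Finset.sum_congr rfl fun l _ => Finset.sum_congr rfl fun m _ => by ring

theorem contract_fromBlocks (A : Matrix ι ι ℝ) (D : Matrix κ κ ℝ) (X Y : Matrix ι ι ℝ)
    (X' Y' : Matrix κ κ ℝ) :
    contract (Matrix.fromBlocks A 0 0 D) (Matrix.fromBlocks X 0 0 X') (Matrix.fromBlocks Y 0 0 Y')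
      = Matrix.fromBlocks (contract A X Y) 0 0 (contract D X' Y') := by
  ext i j
  rcases i with i | i <;> rcases j with j | j <;>
    simp [contract, Fintype.sum_sum_type]

/-- Contractions become matrix products. The transpose stays because no symmetry is assumed; it is
why the symmetry of the Ricci tensor is needed later. -/
theorem contract_eq_mul (A X Y : Matrix ι ι ℝ) : contract A X Y = X * A * Yᵀ := by
  ext i j
  simp only [contract, Matrix.mul_apply, Matrix.transpose_apply, Finset.sum_mul]
  rw [Finset.sum_comm]
  exact Finset.sum_congr rfl fun l _ => Finset.sum_congr rfl fun m _ => by ring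

theorem contract_add_smul_self (A X Y : Matrix ι ι ℝ) (c : ℝ) :
    contract A (X + c • Y) (X + c • Y)
      = contract A X X + c • (contract A X Y + contract A Y X) + c ^ 2 • contract A Y Y := by
  simp only [contract_eq_mul, Matrix.add_mul, Matrix.mul_add, Matrix.transpose_add,
    Matrix.transpose_smul, Matrix.smul_mul, Matrix.mul_smul, smul_add, smul_smul, pow_two]
  abel

theorem contract_smul_inv (A X Y : Matrix ι ι ℝ) (c : ℝ) :
    contract (c • A) X Y = c • contract A X Y := by
  simp only [contract_eq_mul, Matrix.mul_smul, Matrix.smul_mul]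

theorem contract_inv_left {A : Matrix ι ι ℝ} (hA : IsUnit A.det) (Y : Matrix ι ι ℝ) :
    contract A⁻¹ A Y = Yᵀ := by
  rw [contract_eq_mul, Matrix.mul_nonsing_inv _ hA, one_mul]

theorem contract_inv_right {A : Matrix ι ι ℝ} (hA : IsUnit A.det) (hs : Aᵀ = A)
    (Y : Matrix ι ι ℝ) : contract A⁻¹ Y A = Y := by
  rw [contract_eq_mul, hs, mul_assoc, Matrix.nonsing_inv_mul _ hA, mul_one]

theorem metricTrace_inv_self {A : Matrix ι ι ℝ} (hA : IsUnit A.det) (hs : Aᵀ = A) :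
    metricTrace A⁻¹ A = Fintype.card ι := by
  have : metricTrace A⁻¹ A = (A⁻¹ * Aᵀ).trace := by
    simp [metricTrace, Matrix.trace, Matrix.mul_apply]
  rw [this, hs, Matrix.nonsing_inv_mul _ hA, Matrix.trace_one]

theorem ricciContraction_sub (A : Matrix ι ι ℝ) (R R' : ι → ι → ι → ι → ℝ) (c d : ℝ) :
    ricciContraction A (fun i j k l => c * R i j k l - d * R' i j k l)
      = c • ricciContraction A R - d • ricciContraction A R' := by
  ext i j
  simp only [ricciContraction, Matrix.sub_apply, Matrix.smul_apply, smul_eq_mul, Finset.mul_sum,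
    ← Finset.sum_sub_distrib]
  exact Finset.sum_congr rfl fun l _ => Finset.sum_congr rfl fun m _ => by ring

theorem ricciContraction_smul (A : Matrix ι ι ℝ) (R : ι → ι → ι → ι → ℝ) (c : ℝ) :
    ricciContraction (c • A) R = c • ricciContraction A R := by
  ext i j
  simp only [ricciContraction, Matrix.smul_apply, smul_eq_mul, Finset.mul_sum, mul_assoc]

/-- The four terms of `A∧A` agree in pairs: one pair contracts to the dimension times `A`, the other
to `-A`. -/
theorem ricciContraction_kulkarniNomizu_self {A : Matrix ι ι ℝ} (hA : IsUnit A.det) (hs : Aᵀ = A) :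
    ricciContraction A⁻¹ (kulkarniNomizu A A) = (2 * ((Fintype.card ι : ℝ) - 1)) • A := by
  have h1 := metricTrace_inv_self hA hs
  ext i j
  have h2 : ∑ k, ∑ l, A⁻¹ k l * (A k j * A i l) = A i j := by
    have h := congrFun (congrFun (contract_inv_right hA hs A) j) i
    have hs' : ∀ i j, A i j = A j i := fun i j => congrFun (congrFun hs j) i
    rw [hs' i j, ← h]
    refine Finset.sum_congr rfl fun l _ => Finset.sum_congr rfl fun m _ => ?_
    rw [hs' l j]
    ring
  have h3 : ∑ k, ∑ l, A⁻¹ k l * (A k l * A i j) = Fintype.card ι * A i j := by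
    rw [← h1, metricTrace, Finset.sum_mul]
    simp only [Finset.sum_mul, mul_assoc]
  have h4 : ricciContraction A⁻¹ (kulkarniNomizu A A) i j
      = 2 * ∑ k, ∑ l, A⁻¹ k l * (A k l * A i j) - 2 * ∑ k, ∑ l, A⁻¹ k l * (A k j * A i l) := by
    simp only [ricciContraction, kulkarniNomizu, Finset.mul_sum, ← Finset.sum_sub_distrib]
    exact Finset.sum_congr rfl fun l _ => Finset.sum_congr rfl fun m _ => by ring
  rw [h4, h2, h3, Matrix.smul_apply, smul_eq_mul]
  ring

/-- The right hand side of the generalized Roter type condition. -/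
def roterForm (L₁ L₂ L₃ L₄ L₅ L₆ : ℝ) (g S S' : Matrix ι ι ℝ) (i j k l : ι) : ℝ :=
  L₁ * kulkarniNomizu g g i j k l + L₂ * kulkarniNomizu g S i j k l
    + L₃ * kulkarniNomizu S S i j k l + L₄ * kulkarniNomizu g S' i j k l
    + L₅ * kulkarniNomizu S S' i j k l + L₆ * kulkarniNomizu S' S' i j k l

/-- The mixed components of the generalized Roter type condition. -/
def roterMixed (L₁ L₂ L₃ L₄ L₅ L₆ : ℝ) (g S S' : Matrix ι ι ℝ) (k Z Z' : Matrix κ κ ℝ) (a b : ι)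
    (α β : κ) : ℝ :=
  2 * L₁ * (g a b * k α β) + L₂ * (g a b * Z α β + S a b * k α β) + 2 * L₃ * (S a b * Z α β)
    + L₄ * (g a b * Z' α β + S' a b * k α β) + L₅ * (S a b * Z' α β + S' a b * Z α β)
    + 2 * L₆ * (S' a b * Z' α β)

/-- For block diagonal tensors, the generalized Roter type condition splits into the condition on
the base, the mixed one, and the one on the fiber. -/
theorem blockCurvature_eq_roterForm_iff (L₁ L₂ L₃ L₄ L₅ L₆ : ℝ)
    (Rb : ι → ι → ι → ι → ℝ) (T : Matrix ι ι ℝ) (k : Matrix κ κ ℝ) (Rf : κ → κ → κ → κ → ℝ)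
    (g S S' : Matrix ι ι ℝ) (Z Z' : Matrix κ κ ℝ) :
    (∀ i j l m, blockCurvature Rb T k Rf i j l m
      = roterForm L₁ L₂ L₃ L₄ L₅ L₆ (Matrix.fromBlocks g 0 0 k) (Matrix.fromBlocks S 0 0 Z)
        (Matrix.fromBlocks S' 0 0 Z') i j l m) ↔
    (∀ a b c d, Rb a b c d = roterForm L₁ L₂ L₃ L₄ L₅ L₆ g S S' a b c d) ∧
    (∀ a b α β, T a b * k α β = roterMixed L₁ L₂ L₃ L₄ L₅ L₆ g S S' k Z Z' a b α β) ∧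
    (∀ α β γ δ, Rf α β γ δ = roterForm L₁ L₂ L₃ L₄ L₅ L₆ k Z Z' α β γ δ) := by
  constructor
  · intro h
    refine ⟨fun a b c d => h (.inl a) (.inl b) (.inl c) (.inl d), fun a b α β => ?_,
      fun α β γ δ => h (.inr α) (.inr β) (.inr γ) (.inr δ)⟩
    -- One mixed pattern suffices: the other three give the same equation up to sign and
    -- relabelling.
    have := h (.inl a) (.inr α) (.inr β) (.inl b)
    simp only [blockCurvature, roterForm, kulkarniNomizu, Matrix.fromBlocks_apply₁₁,
      Matrix.fromBlocks_apply₁₂, Matrix.fromBlocks_apply₂₁, Matrix.fromBlocks_apply₂₂,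
      Matrix.zero_apply] at this
    rw [this, roterMixed]
    ring
  · rintro ⟨hb, hm, hf⟩ i j l m
    rcases i with i | i <;> rcases j with j | j <;> rcases l with l | l <;> rcases m with m | m
    case inl.inl.inl.inl => exact hb i j l m
    case inr.inr.inr.inr => exact hf i j l m
    -- In the remaining patterns either both sides vanish or `hm` rewrites the left side into the
    -- right one.
    all_goals
      simp only [blockCurvature, hm, roterMixed, roterForm, kulkarniNomizu,
        Matrix.fromBlocks_apply₁₁, Matrix.fromBlocks_apply₁₂, Matrix.fromBlocks_apply₂₁,
        Matrix.fromBlocks_apply₂₂, Matrix.zero_apply]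
      ring

/-- Expansion of the quadratic form at the base blocks of `g, S, S²`. Off-diagonal coefficients are
halved since each unordered pair occurs twice in the double sum. -/
theorem sum_baseTable (q : ℕ) (L₁ L₂ L₃ L₄ L₅ L₆ : ℝ) (g S S' T T' U : Matrix ι ι ℝ)
    (a b c d : ι) :
    ∑ r, ∑ s, baseTable q L₁ L₂ L₃ L₄ L₅ L₆ r s
        * kulkarniNomizu ((![g, S, S', T, T', U] : Fin 6 → Matrix ι ι ℝ) r)
          ((![g, S, S', T, T', U] : Fin 6 → Matrix ι ι ℝ) s) a b c d
      = roterForm L₁ L₂ L₃ L₄ L₅ L₆ g (S + (q : ℝ) • T)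
        (S' + (q : ℝ) • U + (q : ℝ) ^ 2 • T') a b c d := by
  simp [Fin.sum_univ_succ, baseTable, roterForm, kulkarniNomizu]
  ring

/-- The table encodes curvature minus Roter form, hence its signs; the lone `f` in the entry for `T,
g̃` is the curvature block itself. -/
theorem sum_mixedTable (q : ℕ) {f : ℝ} (hf : f ≠ 0) (Q L₁ L₂ L₃ L₄ L₅ L₆ : ℝ)
    (g S S' T T' U : Matrix ι ι ℝ) (k Z Z' : Matrix κ κ ℝ) (a b : ι) (α β : κ) :
    ∑ r, ∑ s, mixedTable q f Q L₁ L₂ L₃ L₄ L₅ L₆ r s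
        * ((![g, S, S', T, T', U] : Fin 6 → Matrix ι ι ℝ) r a b
          * (![k, Z, Z'] : Fin 3 → Matrix κ κ ℝ) s α β)
      = T a b * (f • k) α β - roterMixed L₁ L₂ L₃ L₄ L₅ L₆ g (S + (q : ℝ) • T)
        (S' + (q : ℝ) • U + (q : ℝ) ^ 2 • T') (f • k) (Z + Q • k)
        (f⁻¹ • (Z' + (2 * Q) • Z + Q ^ 2 • k)) a b α β := by
  simp [Fin.sum_univ_succ, mixedTable, roterMixed]
  field_simp
  ring

/-- The extra term is the `P`-correction of the fiber curvature, carried to the other side; it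
accounts for `f²P/2` in the first entry. -/
theorem sum_fiberTable {f : ℝ} (hf : f ≠ 0) (P Q L₁ L₂ L₃ L₄ L₅ L₆ : ℝ)
    (k Z Z' : Matrix κ κ ℝ) (α β γ δ : κ) :
    ∑ r, ∑ s, fiberTable f P Q L₁ L₂ L₃ L₄ L₅ L₆ r s
        * kulkarniNomizu ((![k, Z, Z'] : Fin 3 → Matrix κ κ ℝ) r)
          ((![k, Z, Z'] : Fin 3 → Matrix κ κ ℝ) s) α β γ δ
      = roterForm L₁ L₂ L₃ L₄ L₅ L₆ (f • k) (Z + Q • k)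
        (f⁻¹ • (Z' + (2 * Q) • Z + Q ^ 2 • k)) α β γ δ
        + f ^ 2 / 2 * P * kulkarniNomizu k k α β γ δ := by
  simp [Fin.sum_univ_succ, fiberTable, roterForm, kulkarniNomizu]
  field_simp
  ring

end BlockAlgebra

/-! ### Symmetry of the Ricci tensor -/

section RicciSymmetry

variable {ι : Type*} [Fintype ι] [DecidableEq ι]
variable {E : Type*} [NormedAddCommGroup E] [NormedSpace ℝ E]

namespace IsMetricOn

variable {G : E → Matrix ι ι ℝ} {U : Set E} (hG : IsMetricOn G U) (b : Module.Basis ι ℝ E)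
  {z : E} (hz : z ∈ U)

include hG hz

theorem differentiableAt_inv (i j : ι) : DifferentiableAt ℝ (fun w => (G w)⁻¹ i j) z :=
  differentiableAt_of_contDiffOn hG.isOpen (hG.contDiffOn_inv i j) hz

/-- Differentiate `G G⁻¹ = 1` and multiply by `G⁻¹` on the left. -/
theorem pd_inv (k : ι) :
    (Matrix.of fun i j => pd b k (fun w => (G w)⁻¹ i j) z)
      = -((G z)⁻¹ * (Matrix.of fun i j => pd b k (fun w => G w i j) z) * (G z)⁻¹) := by
  have e : (Matrix.of fun i j => pd b k (fun w => G w i j) z) * (G z)⁻¹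
      + G z * (Matrix.of fun i j => pd b k (fun w => (G w)⁻¹ i j) z) = 0 := by
    ext i j
    have hd : ∀ l, DifferentiableAt ℝ (fun w => G w i l * (G w)⁻¹ l j) z := fun l =>
      (hG.differentiableAt hz i l).fun_mul (hG.differentiableAt_inv hz l j)
    have h0 : pd b k (fun w => ∑ l, G w i l * (G w)⁻¹ l j) z = 0 := by
      rw [pd_congr_of_eqOn b k hG.isOpen hz (k := fun _ => (1 : Matrix ι ι ℝ) i j) fun w hw => by
        rw [← Matrix.mul_nonsing_inv _ (hG.isUnit_det w hw), Matrix.mul_apply]]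
      simp [pd]
    rw [pd_sum b k hd] at h0
    simp only [Matrix.add_apply, Matrix.mul_apply, Matrix.of_apply, Matrix.zero_apply,
      ← Finset.sum_add_distrib]
    rw [← h0]
    exact Finset.sum_congr rfl fun l _ =>
      (pd_mul b k (hG.differentiableAt hz i l) (hG.differentiableAt_inv hz l j)).symm
  have h1 := congrArg ((G z)⁻¹ * ·) e
  simp only [Matrix.mul_add, ← Matrix.mul_assoc, Matrix.nonsing_inv_mul _ (hG.isUnit_det z hz),
    Matrix.one_mul, Matrix.mul_zero] at h1
  exact eq_neg_of_add_eq_zero_right h1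

theorem sum_christoffel_trace (j : ι) :
    ∑ l, christoffel b G l j l z
      = (1 / 2) * ∑ l, ∑ m, (G z)⁻¹ l m * pd b j (fun w => G w l m) z := by
  have e : ∑ l, ∑ m, (G z)⁻¹ l m * pd b l (fun w => G w j m) z
      = ∑ l, ∑ m, (G z)⁻¹ l m * pd b m (fun w => G w j l) z := by
    rw [Finset.sum_comm]
    exact Finset.sum_congr rfl fun l _ => Finset.sum_congr rfl fun m _ => by
      rw [hG.inv_symm hz]
  simp only [christoffel, mul_add, mul_sub, Finset.sum_add_distrib, Finset.sum_sub_distrib,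
    ← Finset.mul_sum, e]
  ring

/-- The contracted symbol is `½ ∂_j log |det G|`, so this is symmetry of a Hessian. The logarithm is
avoided by differentiating the trace `½ tr(G⁻¹ ∂_j G)`. -/
theorem pd_sum_christoffel_symm (j k : ι) :
    ∑ l, pd b k (christoffel b G l j l) z = ∑ l, pd b j (christoffel b G l k l) z := by
  have hp : ∀ j l m, DifferentiableAt ℝ (pd b j fun w => G w l m) z := fun j l m =>
    differentiableAt_of_contDiffOn hG.isOpen (contDiffOn_pd b j hG.isOpen (hG.contDiffOn l m)) hz
  have hm : ∀ j l m, DifferentiableAt ℝ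
      (fun w => (G w)⁻¹ l m * pd b j (fun w => G w l m) w) z := fun j l m =>
    (hG.differentiableAt_inv hz l m).fun_mul (hp j l m)
  have key : ∀ j k, ∑ l, pd b k (christoffel b G l j l) z
      = (1 / 2) * (-((G z)⁻¹ * (Matrix.of fun i j => pd b k (fun w => G w i j) z) * (G z)⁻¹
          * (Matrix.of fun l m => pd b j (fun w => G w l m) z)).trace
        + ∑ l, ∑ m, (G z)⁻¹ l m * pd b k (pd b j fun w => G w l m) z) := by
    intro j k
    have hs : (Matrix.of fun l m => pd b j (fun w => G w l m) z)ᵀ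
        = Matrix.of fun l m => pd b j (fun w => G w l m) z :=
      Matrix.ext fun l m => hG.pd_symm b hz j m l
    rw [← Matrix.trace_neg, ← Matrix.neg_mul, ← hG.pd_inv b hz k, ← hs,
      ← pd_sum b k fun l => hG.differentiableAt_christoffel b hz l j l,
      pd_congr_of_eqOn b k hG.isOpen hz fun w hw => hG.sum_christoffel_trace b hw j,
      pd_const_mul b k _ (.fun_sum fun l _ => .fun_sum fun m _ => hm j l m),
      pd_sum b k fun l => .fun_sum fun m _ => hm j l m]
    simp only [Matrix.trace, Matrix.diag_apply, Matrix.mul_apply, Matrix.of_apply,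
      Matrix.transpose_apply, ← Finset.sum_add_distrib]
    congr 1
    refine Finset.sum_congr rfl fun l _ => ?_
    rw [pd_sum b k fun m => hm j l m]
    exact Finset.sum_congr rfl fun m _ =>
      pd_mul b k (hG.differentiableAt_inv hz l m) (hp j l m)
  rw [key, key]
  congr 2
  -- Cyclicity of the trace makes `tr(G⁻¹ ∂_kG G⁻¹ ∂_jG)` symmetric in `j, k`.
  · rw [Matrix.mul_assoc, Matrix.trace_mul_comm]
    simp only [Matrix.mul_assoc]
  · exact Finset.sum_congr rfl fun l _ => Finset.sum_congr rfl fun m _ => by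
      rw [pd_comm b k j hG.isOpen (hG.contDiffOn l m) hz]

theorem ricciContraction_riemann (j k : ι) :
    ricciContraction (G z)⁻¹ (riemann b G z) j k
      = ∑ l, (pd b l (christoffel b G l j k) z - pd b k (christoffel b G l j l) z
        + ∑ m, (christoffel b G m j k z * christoffel b G l m l z
          - christoffel b G m j l z * christoffel b G l m k z)) := by
  rw [ricciContraction, Finset.sum_comm]
  refine Finset.sum_congr rfl fun l _ => ?_
  have := hG.isUnit_det z hz
  have e := congrFun (Matrix.mulVec_mulVec (fun n => pd b l (christoffel b G n j k) z
    - pd b k (christoffel b G n j l) z + ∑ m, (christoffel b G m j k z * christoffel b G n m l z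
          - christoffel b G m j l z * christoffel b G n m k z)) (G z)⁻¹ (G z)) l
  rw [Matrix.nonsing_inv_mul _ this, Matrix.one_mulVec] at e
  rw [← e]
  exact Finset.sum_congr rfl fun i _ => by rw [hG.inv_symm hz]; rfl

/-- Each of the four sums is symmetric: the first and third by torsion-freeness, the second by
`pd_sum_christoffel_symm`, the last by exchanging the summation indices. -/
theorem ricciContraction_symm (j k : ι) :
    ricciContraction (G z)⁻¹ (riemann b G z) j k = ricciContraction (G z)⁻¹ (riemann b G z) k j := by
  have e1 : ∀ l, pd b l (christoffel b G l j k) z = pd b l (christoffel b G l k j) z := fun l =>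
    pd_congr_of_eqOn b l hG.isOpen hz fun w hw => hG.christoffel_symm b hw l j k
  have e2 : ∑ l, ∑ m, christoffel b G m j l z * christoffel b G l m k z
      = ∑ l, ∑ m, christoffel b G m k l z * christoffel b G l m j z := by
    rw [Finset.sum_comm]
    exact Finset.sum_congr rfl fun l _ => Finset.sum_congr rfl fun m _ => by
      rw [hG.christoffel_symm b hz l j m, hG.christoffel_symm b hz m l k, mul_comm]
  simp only [hG.ricciContraction_riemann b hz, Finset.sum_add_distrib, Finset.sum_sub_distrib,
    e1, e2, hG.pd_sum_christoffel_symm b hz j k, hG.christoffel_symm b hz _ j k]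

end IsMetricOn

end RicciSymmetry

/-! ### Metrics in charts -/

section Charts

variable {E : Type*} [NormedAddCommGroup E] [NormedSpace ℝ E]
  {H : Type*} [TopologicalSpace H] {I : ModelWithCorners ℝ E H} [I.Boundaryless]
  {B : Type*} [TopologicalSpace B] [ChartedSpace H B] [IsManifold I ∞ B]
  {ι : Type*} [Fintype ι] [DecidableEq ι] (b : Module.Basis ι ℝ E)

namespace SemiRiemannianMetric

variable (g : SemiRiemannianMetric I B)

/-- The coordinate change on tangent spaces is invertible, so a null vector of the component matrix
would be a nonzero vector in the radical of the metric. -/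
theorem isUnit_det_coord (x : B) {z : E} (hz : z ∈ (extChartAt I x).target) :
    IsUnit (g.coord b x z).det := by
  set y := (extChartAt I x).symm z with hy
  have hys : y ∈ (extChartAt I x).source := (extChartAt I x).map_target hz
  rw [isUnit_iff_ne_zero]
  intro h0
  obtain ⟨v, hv, hv0⟩ := Matrix.exists_mulVec_eq_zero_iff.2 h0
  have inv : ∀ u : E, tangentCoordChange I y x y (tangentCoordChange I x y y u) = u := fun u => by
    rw [tangentCoordChange_comp ⟨⟨hys, mem_extChartAt_source y⟩, hys⟩,
      tangentCoordChange_self hys]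
  have inv' : ∀ u : E, tangentCoordChange I x y y (tangentCoordChange I y x y u) = u := fun u => by
    rw [tangentCoordChange_comp ⟨⟨mem_extChartAt_source y, hys⟩, mem_extChartAt_source y⟩,
      tangentCoordChange_self (mem_extChartAt_source y)]
  let τ : E →ₗ[ℝ] TangentSpace I y := (tangentCoordChange I x y y).toLinearMap
  let β : E →ₗ[ℝ] E →ₗ[ℝ] ℝ := LinearMap.compl₁₂ (g.val y) τ τ
  -- The matrix equation tests the form only on basis vectors; linearity extends it to all vectors.
  have hβ : β.flip (∑ i, v i • b i) = 0 := b.ext fun i => by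
    have h := congrFun hv0 i
    simp only [Matrix.mulVec, dotProduct] at h
    rw [LinearMap.flip_apply]
    simp only [map_sum, map_smul, smul_eq_mul, LinearMap.zero_apply]
    exact (Finset.sum_congr rfl fun j _ => mul_comm _ _).trans h
  have key : tangentCoordChange I x y y (∑ i, v i • b i) = 0 := by
    refine g.nondegenerate y _ fun w => ?_
    have h := LinearMap.congr_fun hβ (tangentCoordChange I y x y w)
    have h' : g.val y (τ (tangentCoordChange I y x y w)) (τ (∑ i, v i • b i)) = 0 := h
    have e : τ (tangentCoordChange I y x y w) = w := inv' w
    rw [e, g.symm] at h'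
    exact h'
  have h1 : ∑ i, v i • b i = 0 := by
    rw [← inv (∑ i, v i • b i), key, map_zero]
  exact hv (funext fun i => Fintype.linearIndependent_iff.1 b.linearIndependent v h1 i)

theorem isMetricOn_coord (x : B) : IsMetricOn (g.coord b x) (extChartAt I x).target where
  isOpen := isOpen_extChartAt_target x
  symm _ _ _ _ := g.symm _ _ _
  isUnit_det _ hz := g.isUnit_det_coord b x hz
  contDiffOn i j := g.smooth x (b i) (b j)

theorem contDiffOn_localRep {f : B → ℝ} (hf : ContMDiff I 𝓘(ℝ, ℝ) ∞ f) (x : B) :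
    ContDiffOn ℝ ∞ (localRep I f x) (extChartAt I x).target :=
  contMDiffOn_iff_contDiffOn.1 (hf.comp_contMDiffOn (contMDiffOn_extChartAt_symm x))

theorem localRep_self (f : B → ℝ) (x : B) : localRep I f x (extChartAt I x x) = f x := by
  rw [localRep, extChartAt_to_inv]

theorem tensorT_eq (f : B → ℝ) (x : B) :
    g.tensorT b f x = warpingTensor b (g.coord b x) (localRep I f x) (extChartAt I x x) := by
  funext i j
  rw [tensorT, warpingTensor, localRep_self]
  rfl

theorem scalarP_eq (f : B → ℝ) (x : B) :
    g.scalarP b f x = warpingScalar b (g.coord b x) (localRep I f x) (extChartAt I x x) := by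
  rw [scalarP, warpingScalar, localRep_self]
  rfl

theorem metric_transpose (x : B) : (g.metric b x)ᵀ = g.metric b x :=
  Matrix.ext fun _ _ => g.symm _ _ _

theorem isUnit_det_metric (x : B) : IsUnit (g.metric b x).det :=
  g.isUnit_det_coord b x (mem_extChartAt_target x)

theorem ricci_transpose (x : B) : (g.ricci b x)ᵀ = g.ricci b x :=
  Matrix.ext fun i j =>
    (g.isMetricOn_coord b x).ricciContraction_symm b (mem_extChartAt_target x) j i

end SemiRiemannianMetric

end Charts

/-! ### The tensors of a warped product -/

section WarpedProduct

variable {E : Type*} [NormedAddCommGroup E] [NormedSpace ℝ E]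
  {H : Type*} [TopologicalSpace H] {I : ModelWithCorners ℝ E H} [I.Boundaryless]
  {B : Type*} [TopologicalSpace B] [ChartedSpace H B] [IsManifold I ∞ B]
  {E' : Type*} [NormedAddCommGroup E'] [NormedSpace ℝ E']
  {H' : Type*} [TopologicalSpace H'] {I' : ModelWithCorners ℝ E' H'} [I'.Boundaryless]
  {F : Type*} [TopologicalSpace F] [ChartedSpace H' F] [IsManifold I' ∞ F]
  {ι κ : Type*} [Fintype ι] [DecidableEq ι] [Fintype κ] [DecidableEq κ]
  (b : Module.Basis ι ℝ E) (b' : Module.Basis κ ℝ E')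
  (gB : SemiRiemannianMetric I B) (gF : SemiRiemannianMetric I' F)
  {f : B → ℝ} (hf : ContMDiff I 𝓘(ℝ, ℝ) ∞ f) (hpos : ∀ x, 0 < f x) (x : B) (y : F)

open SemiRiemannianMetric

theorem extChartAt_prod_target :
    (extChartAt (I.prod I') (x, y)).target
      = (extChartAt I x).target ×ˢ (extChartAt I' y).target := by
  rw [extChartAt_prod, PartialEquiv.prod_target]

include hf hpos in
theorem isWarpedOn_coord :
    IsWarpedOn (gB.coord b x) (localRep I f x) (gF.coord b' y) (extChartAt I x).target
      (extChartAt I' y).target where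
  base := gB.isMetricOn_coord b x
  fiber := gF.isMetricOn_coord b' y
  contDiffOn := contDiffOn_localRep hf x
  ne_zero _ _ := (hpos _).ne'

/-- The chart at `(x, y)` is the product chart, and each vector of `b.prod b'` lies in one factor,
so its tangent coordinate change does too. The identity is needed on the whole chart target because
the curvature takes two derivatives. -/
theorem coord_warpedMetric {z : E × E'} (hz : z ∈ (extChartAt (I.prod I') (x, y)).target) :
    (warpedMetric gB gF f hf hpos).coord (b.prod b') (x, y) z
      = warpedMatrix (gB.coord b x) (localRep I f x) (gF.coord b' y) z := by
  have hs := (extChartAt (I.prod I') (x, y)).map_target hz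
  have e : (extChartAt (I.prod I') (x, y)).symm z
      = ((extChartAt I x).symm z.1, (extChartAt I' y).symm z.2) := by
    rw [extChartAt_prod]; rfl
  have a := fun u => tangentCoordChange_prod_apply (I := I) (I' := I') (x, y) _ hs u
  ext i j
  change gB.val _ (tangentCoordChange (I.prod I') (x, y) _ _ _).1
      (tangentCoordChange (I.prod I') (x, y) _ _ _).1
    + f _ * gF.val _ (tangentCoordChange (I.prod I') (x, y) _ _ _).2
      (tangentCoordChange (I.prod I') (x, y) _ _ _).2 = _
  rw [a, a, e]
  have l1 : ∀ x (v : E), gB.val x (0 : E) v = 0 := fun x v => LinearMap.map_zero₂ (gB.val x) v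
  have r1 : ∀ x (v : E), gB.val x v (0 : E) = 0 := fun x v => map_zero (gB.val x v)
  have l2 : ∀ y (v : E'), gF.val y (0 : E') v = 0 := fun y v => LinearMap.map_zero₂ (gF.val y) v
  have r2 : ∀ y (v : E'), gF.val y v (0 : E') = 0 := fun y v => map_zero (gF.val y v)
  rcases i with i | i <;> rcases j with j | j <;>
    simp only [Module.Basis.prod_apply_inl_fst, Module.Basis.prod_apply_inl_snd,
      Module.Basis.prod_apply_inr_fst, Module.Basis.prod_apply_inr_snd, map_zero, l1, r1, l2, r2,
      mul_zero, add_zero, zero_add] <;>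
    rfl

theorem metric_warpedMetric :
    (warpedMetric gB gF f hf hpos).metric (b.prod b') (x, y)
      = Matrix.fromBlocks (gB.metric b x) 0 0 (f x • gF.metric b' y) := by
  rw [metric, coord_warpedMetric b b' gB gF hf hpos x y (mem_extChartAt_target _), warpedMatrix,
    extChartAt_prod]
  change Matrix.fromBlocks (gB.coord b x (extChartAt I x x)) 0 0
    (localRep I f x (extChartAt I x x) • gF.coord b' y (extChartAt I' y y)) = _
  rw [localRep_self]
  rfl

theorem inv_warpedMetric :
    (warpedMetric gB gF f hf hpos).inv (b.prod b') (x, y)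
      = Matrix.fromBlocks (gB.inv b x) 0 0 ((f x)⁻¹ • gF.inv b' y) := by
  rw [inv, metric_warpedMetric]
  exact inv_fromBlocks_diag_smul (gB.isUnit_det_metric b x) (gF.isUnit_det_metric b' y)
    (hpos x).ne'

theorem curvature_warpedMetric :
    (warpedMetric gB gF f hf hpos).curvature (b.prod b') (x, y)
      = blockCurvature (gB.curvature b x) (gB.tensorT b f x) (f x • gF.metric b' y)
        (fun i j k l => f x * gF.curvature b' y i j k l - f x ^ 2 / 2 * gB.scalarP b f x
          * kulkarniNomizu (gF.metric b' y) (gF.metric b' y) i j k l) := by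
  have ho : IsOpen (extChartAt (I.prod I') (x, y)).target := by
    rw [extChartAt_prod_target]
    exact (isOpen_extChartAt_target x).prod (isOpen_extChartAt_target y)
  have hz := mem_extChartAt_target (I := I.prod I') (x, y)
  have e : (warpedMetric gB gF f hf hpos).coord (b.prod b') (x, y)
      =ᶠ[𝓝 (extChartAt (I.prod I') (x, y) (x, y))]
        warpedMatrix (gB.coord b x) (localRep I f x) (gF.coord b' y) :=
    eventually_of_mem (ho.mem_nhds hz) fun z hz => coord_warpedMetric b b' gB gF hf hpos x y hz
  rw [extChartAt_prod_target] at hz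
  rw [curvature, riemann_congr _ e,
    (isWarpedOn_coord b b' gB gF hf hpos x y).riemann_eq_blockCurvature b b' hz, extChartAt_prod,
    tensorT_eq, scalarP_eq]
  change blockCurvature _ _ (localRep I f x (extChartAt I x x) • _) (fun i j k l =>
    localRep I f x (extChartAt I x x) * _ - localRep I f x (extChartAt I x x) ^ 2 / 2 * _ * _) = _
  rw [localRep_self]
  rfl

/-- The trace of `f g̃` with respect to `f⁻¹ g̃⁻¹` is the fiber dimension. On the fiber, `f tr T`
comes from the mixed block and `-(q - 1) f P` from the `g̃∧g̃` correction; together they form `Q`.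
-/
theorem ricci_warpedMetric :
    (warpedMetric gB gF f hf hpos).ricci (b.prod b') (x, y)
      = Matrix.fromBlocks (gB.ricci b x + (Fintype.card κ : ℝ) • gB.tensorT b f x) 0 0
        (gF.ricci b' y + gB.scalarQ b (Fintype.card κ) f x • gF.metric b' y) := by
  have h0 := (hpos x).ne'
  have hu := gF.isUnit_det_metric b' y
  have hs := gF.metric_transpose b' y
  have ht : metricTrace ((f x)⁻¹ • gF.inv b' y) (f x • gF.metric b' y) = Fintype.card κ := by
    rw [← metricTrace_inv_self hu hs]
    simp only [metricTrace, Matrix.smul_apply, smul_eq_mul, inv]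
    exact Finset.sum_congr rfl fun l _ => Finset.sum_congr rfl fun m _ => by field_simp
  rw [ricci, inv_warpedMetric, curvature_warpedMetric, ricciContraction_blockCurvature, ht,
    ricciContraction_smul, ricciContraction_sub]
  congr 1
  have hk := ricciContraction_kulkarniNomizu_self hu hs
  rw [← inv] at hk
  rw [hk]
  ext i j
  simp only [Matrix.add_apply, Matrix.sub_apply, Matrix.smul_apply, smul_eq_mul, scalarQ, ricci,
    inv]
  field_simp
  ring

/-- The inverse metric supplies `f⁻¹` on the fiber. The cross terms of `S̃` with `Q g̃` contract to
`S̃` and its transpose, which agree by `ricci_transpose`. -/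
theorem ricciSq_warpedMetric :
    (warpedMetric gB gF f hf hpos).ricciSq (b.prod b') (x, y)
      = Matrix.fromBlocks (gB.ricciSq b x + (Fintype.card κ : ℝ) • gB.tensorST b f x
          + (Fintype.card κ : ℝ) ^ 2 • gB.tensorTSq b f x) 0 0
        ((f x)⁻¹ • (gF.ricciSq b' y
          + (2 * gB.scalarQ b (Fintype.card κ) f x) • gF.ricci b' y
          + gB.scalarQ b (Fintype.card κ) f x ^ 2 • gF.metric b' y)) := by
  have hu := gF.isUnit_det_metric b' y
  have hs := gF.metric_transpose b' y
  rw [ricciSq, ricci_warpedMetric, inv_warpedMetric, contract_fromBlocks, contract_add_smul_self,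
    contract_smul_inv, contract_add_smul_self]
  have hl := fun Y => contract_inv_left hu Y
  have hr := fun Y => contract_inv_right hu hs Y
  rw [← inv] at hl hr
  rw [hl, hl, hr, ricci_transpose, hs, ← two_smul ℝ (gF.ricci b' y), smul_smul, mul_comm]
  rfl

end WarpedProduct

end WarpedRoter

/-! ### The theorem, assembled pointwise -/

theorem theorem5p1 {p q : ℕ} (hp : 1 ≤ p) (hq : 1 ≤ q)
    (B : Type*) [TopologicalSpace B] [T2Space B] [SecondCountableTopology B] [ConnectedSpace B]
    [ChartedSpace (EuclideanSpace ℝ (Fin p)) B] [IsManifold (𝓡 p) ∞ B]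
    (F : Type*) [TopologicalSpace F] [T2Space F] [SecondCountableTopology F] [ConnectedSpace F]
    [ChartedSpace (EuclideanSpace ℝ (Fin q)) F] [IsManifold (𝓡 q) ∞ F]
    (gB : WarpedRoter.SemiRiemannianMetric (𝓡 p) B)
    (gF : WarpedRoter.SemiRiemannianMetric (𝓡 q) F)
    (f : B → ℝ) (hf : ContMDiff (𝓡 p) 𝓘(ℝ, ℝ) ∞ f) (hpos : ∀ x, 0 < f x)
    (L₁ L₂ L₃ L₄ L₅ L₆ : B × F → ℝ) :
    (WarpedRoter.warpedMetric gB gF f hf hpos).IsGeneralizedRoterTypeWith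
        ((WarpedRoter.stdBasis p).prod (WarpedRoter.stdBasis q))
        L₁ L₂ L₃ L₄ L₅ L₆ ↔
      (∀ (x : B) (y : F), WarpedRoter.BaseCondition gB q f x
        (L₁ (x, y)) (L₂ (x, y)) (L₃ (x, y)) (L₄ (x, y)) (L₅ (x, y)) (L₆ (x, y))) ∧
      (∀ (x : B) (y : F), WarpedRoter.MixedCondition gB gF f x y
        (L₁ (x, y)) (L₂ (x, y)) (L₃ (x, y)) (L₄ (x, y)) (L₅ (x, y)) (L₆ (x, y))) ∧
      (∀ (x : B) (y : F), WarpedRoter.FiberCondition gB gF f x y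
        (L₁ (x, y)) (L₂ (x, y)) (L₃ (x, y)) (L₄ (x, y)) (L₅ (x, y)) (L₆ (x, y))) := by
  -- The algebraic splitting at a fixed point, instantiated with the actual blocks of the metric,
  -- the curvature, `S` and `S²`.
  have key := fun (x : B) (y : F) => WarpedRoter.blockCurvature_eq_roterForm_iff
    (L₁ (x, y)) (L₂ (x, y)) (L₃ (x, y)) (L₄ (x, y)) (L₅ (x, y)) (L₆ (x, y))
    (gB.curvature (WarpedRoter.stdBasis p) x) (gB.tensorT (WarpedRoter.stdBasis p) f x)
    (f x • gF.metric (WarpedRoter.stdBasis q) y)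
    (fun i j k l => f x * gF.curvature (WarpedRoter.stdBasis q) y i j k l
      - f x ^ 2 / 2 * gB.scalarP (WarpedRoter.stdBasis p) f x
        * WarpedRoter.kulkarniNomizu (gF.metric (WarpedRoter.stdBasis q) y)
          (gF.metric (WarpedRoter.stdBasis q) y) i j k l)
    (gB.metric (WarpedRoter.stdBasis p) x)
    (gB.ricci (WarpedRoter.stdBasis p) x + (q : ℝ) • gB.tensorT (WarpedRoter.stdBasis p) f x)
    (gB.ricciSq (WarpedRoter.stdBasis p) x + (q : ℝ) • gB.tensorST (WarpedRoter.stdBasis p) f x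
      + (q : ℝ) ^ 2 • gB.tensorTSq (WarpedRoter.stdBasis p) f x)
    (gF.ricci (WarpedRoter.stdBasis q) y
      + gB.scalarQ (WarpedRoter.stdBasis p) q f x • gF.metric (WarpedRoter.stdBasis q) y)
    ((f x)⁻¹ • (gF.ricciSq (WarpedRoter.stdBasis q) y
      + (2 * gB.scalarQ (WarpedRoter.stdBasis p) q f x) • gF.ricci (WarpedRoter.stdBasis q) y
      + gB.scalarQ (WarpedRoter.stdBasis p) q f x ^ 2 • gF.metric (WarpedRoter.stdBasis q) y))
  -- The tables fold back into `roterForm` and `roterMixed`; `sub_eq_iff_eq_add` returns the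
  -- `P`-term to the fiber curvature, so the three conditions take the shape of `key`.
  simp only [WarpedRoter.BaseCondition, WarpedRoter.baseTensors, WarpedRoter.sum_baseTable,
    WarpedRoter.MixedCondition, WarpedRoter.fiberTensors,
    WarpedRoter.sum_mixedTable _ (hpos _).ne', WarpedRoter.FiberCondition,
    WarpedRoter.sum_fiberTable (hpos _).ne', sub_eq_zero, ← sub_eq_iff_eq_add, ← forall_and, ← key]
  simp only [WarpedRoter.SemiRiemannianMetric.IsGeneralizedRoterTypeWith, Prod.forall,
    WarpedRoter.curvature_warpedMetric, WarpedRoter.metric_warpedMetric,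
    WarpedRoter.ricci_warpedMetric, WarpedRoter.ricciSq_warpedMetric, Fintype.card_fin]
  rfl
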